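/- **Setting.** Let $G$ be a finite polygon decomposition of the (oriented) torus, with sets of vertices $\mathcal G_0$, oriented edges $\mathcal G_1$ and faces $\mathcal G_2$, in which every edge lies between two different vertices and between two different faces. The dual edge $e^*$ crosses $e$ from right to left, leading from the face on the right of $e$ to the face on its left. Let $d\ge 1$, $\omega=e^{2\pi \mathrm i/d}$, and let $\mathcal H_G=\bigotimes_{e\in\mathcal G_1}\mathbb C^d$. On $\mathbb C^d$ with orthonormal basis $(l_i)_{i\in\mathbb Z_d}$ let $Xl_i=l_{i+1}$ and $Zl_i=\omega^i l_i$. For a $1$-chain $\gamma=\sum_e c_e e$ and a $1$-cochain (chain of dual edges) $\gamma^*=\sum_e c^*_{e}e^*$ with coefficients in $\mathbb Z_d$ put $Z_\gamma=\prod_e Z_e^{c_e}$ and $X_{\gamma^*}=\prod_e X_e^{c^*_e}$. For a vertex $v$ let $a_v$ be the product of $X_e$ over the edges coming into $v$ and of $X_e^{-1}$ over the edges going out of $v$; for a face $f$ let $b_f=Z_{\partial f}$. Let $A_v=\frac1d\sum_{j=0}^{d-1}a_v^j$, $B_f=\frac1d\sum_{j=0}^{d-1}b_f^j$ and $H_G=-\sum_vA_v-\sum_fB_f$,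 and let $\mathcal S_G$ be the ground state space of $H_G$, i.e. the eigenspace of its smallest eigenvalue. A walk (sequence of consecutive edges, each run through in either direction) is identified with the $1$-chain that is the signed sum of its edges; a cowalk from a face to a face is a walk in the dual decomposition, identified with a $1$-cochain. Let $\lambda,\tau_0$ be integral cycles whose classes form a basis of $H_1(G;\mathbb Z)$ and $\lambda^*,\tau_0^*$ integral cocycles whose classes form a basis of the first homology of the dual decomposition, such that, for the algebraic crossing number $\langle c,c^*\rangle=\sum_e c_ec^*_e$, one has $\langle\lambda,\lambda^*\rangle=\langle\tau_0,\tau_0^*\rangle=0$, $\langle\lambda,\tau_0^*\rangle>0$ and $\langle\tau_0,\lambda^*\rangle>0$. We call these elementary (co)cycles. Let $Z_{0,1}$ denote $Z_c$ for any $\mathbb Z_d$-cycle $c$ homologous to $\tau_0$ modulo $d$, and $X_{1,0}$ denote $X_{c^*}$ for any $\mathbb Z_d$-cocycle $c^*$ cohomologous to $\lambda^*$ modulo $d$. For a vertex $v$ and a cowalk $\gamma^*$ from a face $f$ to a face $\tilde f$, a *braiding loop* is a closed walk $\tau$ from $v$ to $v$ that is a boundary (over $\mathbb Z_d$) and has a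 single edge in common with $\gamma^*$ (as $\mathbb Z_d$-chains), where $\gamma^*$ crosses $\tau$ once, from left to right, i.e. $\tau$ runs counterclockwise around $f$: the product of the two coefficients at this edge is $-1$. The corresponding physical braiding of the $Z$-particle at $v$ around the $X$-particle at $f$ is $B\varphi=Z_\tau\varphi$. **Theorem.** Let $v\ne\tilde v$ be vertices and $f\ne\tilde f$ faces of $G$, let $0\neq\Psi\in\mathcal S_G$, and let $$\mathcal V_{XZ}=\mathrm{span}\{X_{\gamma^*}Z_\gamma\Psi:\ \gamma\text{ a walk from }v\text{ to }\tilde v,\ \gamma^*\text{ a cowalk from }f\text{ to }\tilde f\}.$$ 1. $\mathcal V_{XZ}=X_{\gamma^*}Z_\gamma\mathcal S_G$ for every walk $\gamma$ from $v$ to $\tilde v$ and every cowalk $\gamma^*$ from $f$ to $\tilde f$. In particular, (a) $\dim\mathcal V_{XZ}=\dim\mathcal S_G$, and (b) $\mathcal V_{XZ}$ does not depend on the choice of $0\ne\Psi\in\mathcal S_G$. 2. Elementary (co)cycles exist, and for every cowalk $\gamma^*$ from $f$ to $\tilde f$ that visits no face twice there is a braiding loop at $v$. For every cowalk $\gamma^*$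 from $f$ to $\tilde f$, every braiding loop $\tau$ at $v$ for $\gamma^*$, every choice of elementary (co)cycles and of the representatives defining $X_{1,0}$ and $Z_{0,1}$, and every $\varphi\in\mathcal V_{XZ}$, $$B\varphi=\left(X_{1,0}Z_{0,1}X_{1,0}^{-1}Z_{0,1}^{-1}\right)\varphi\qquad\text{and}\qquad B\varphi=\omega^{-1}\varphi .$$ -/

import Mathlib

/-!
Kitaev's abelian (`ℤ/d`) models on a polygon decomposition of a closed connected oriented surface,
and the states with one particle-antiparticle pair of each of the two types.
-/

namespace Kitaev

/-! ### Polygon decompositions -/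

/-- The two directed versions of every edge: `(e, true)` is `e` with its fixed orientation and
`(e, false)` is `e` with the opposite orientation. -/
abbrev Dart (E : Type*) := E × Bool

/-- Orientation reversal of darts. -/
def flip (E : Type*) : Equiv.Perm (Dart E) :=
  (Equiv.refl E).prodCongr Equiv.boolNot

/-- A (finite) polygon decomposition, with edge set `E`, of a closed connected oriented surface,
encoded as usual by its rotation system. The permutation `rotation` sends a dart to the next dart,
counterclockwise, with the same initial vertex. The vertices are the cycles of `rotation`; the faces
are the cycles of `faceRotation`, which sends a dart to the next one on the boundary of the face to
its left. Every edge lies between two different vertices and between two different faces. -/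
structure PolygonDecomposition (E : Type*) where
  rotation : Equiv.Perm (Dart E)
  nonempty : Nonempty E
  connected : MulAction.IsPretransitive
    (Subgroup.closure ({rotation, flip E} : Set (Equiv.Perm (Dart E)))) (Dart E)
  ends_ne : ∀ e : E, ¬ rotation.SameCycle (e, true) (e, false)
  sides_ne : ∀ e : E, ¬ (rotation⁻¹ * flip E).SameCycle (e, true) (e, false)

namespace PolygonDecomposition

variable {E : Type*} (G : PolygonDecomposition E)

/-- Follow a dart to its end and then take the next dart clockwise: the next dart on the
(counterclockwise) boundary of the face on the left. -/
def faceRotation : Equiv.Perm (Dart E) := G.rotation⁻¹ * flip E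

def Vertex : Type _ := Quotient (Equiv.Perm.SameCycle.setoid G.rotation)

def Face : Type _ := Quotient (Equiv.Perm.SameCycle.setoid G.faceRotation)

instance [Finite E] : Finite G.Vertex :=
  inferInstanceAs (Finite (Quotient (Equiv.Perm.SameCycle.setoid G.rotation)))

instance [Finite E] : Finite G.Face :=
  inferInstanceAs (Finite (Quotient (Equiv.Perm.SameCycle.setoid G.faceRotation)))

noncomputable instance [Finite E] : Fintype G.Vertex := Fintype.ofFinite _

noncomputable instance [Finite E] : Fintype G.Face := Fintype.ofFinite _

/-- Initial vertex of a dart. -/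
def src (a : Dart E) : G.Vertex := Quotient.mk _ a

/-- Final vertex of a dart. -/
def tgt (a : Dart E) : G.Vertex := G.src (flip E a)

/-- The face on the left of a dart. -/
def left (a : Dart E) : G.Face := Quotient.mk _ a

/-- The face on the right of a dart. -/
def right (a : Dart E) : G.Face := G.left (flip E a)

/-- The surface has genus `g`: its Euler characteristic is `2 - 2g`. -/
def HasGenus (g : ℕ) : Prop :=
  (Nat.card G.Vertex : ℤ) - Nat.card E + Nat.card G.Face = 2 - 2 * g

/-! ### Chains, cochains, (co)cycles and (co)boundaries

Both `1`-chains and `1`-cochains (chains of dual edges) with coefficients in `R` are functions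
`E → R`. The dual edge `e*` crosses `e` from right to left, so that `(e, e*)` is positively
oriented. -/

section Chains

variable (R : Type*) [CommRing R]

open Classical in
/-- `+1` if `e` is incoming at `v`, `-1` if it is outgoing, `0` otherwise. -/
noncomputable def vertexSign (v : G.Vertex) (e : E) : R :=
  (if G.tgt (e, true) = v then 1 else 0) - (if G.src (e, true) = v then 1 else 0)

open Classical in
/-- `+1` if `e` is on the boundary of `f` with the positive orientation (`f` is on its left), `-1`
if it is so with the negative orientation, `0` otherwise. -/
noncomputable def faceSign (f : G.Face) (e : E) : R :=
  (if G.left (e, true) = f then 1 else 0) - (if G.right (e, true) = f then 1 else 0)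

variable [Fintype E]

/-- The boundary `∂₁` of `1`-chains. -/
noncomputable def bdry₁ : (E → R) →ₗ[R] (G.Vertex → R) where
  toFun c := fun v => ∑ e, c e * G.vertexSign R v e
  map_add' a b := by ext v; simp [add_mul, Finset.sum_add_distrib]
  map_smul' r a := by ext v; simp [Finset.mul_sum, mul_assoc]

/-- The boundary `∂₂` of `2`-chains. -/
noncomputable def bdry₂ : (G.Face → R) →ₗ[R] (E → R) where
  toFun c := fun e => ∑ f, c f * G.faceSign R f e
  map_add' a b := by ext e; simp [add_mul, Finset.sum_add_distrib]
  map_smul' r a := by ext e; simp [Finset.mul_sum, mul_assoc]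

/-- The boundary of chains of dual edges; `e*` goes from the face on the right of `e` to the face on
the left of `e`. -/
noncomputable def cobdry₁ : (E → R) →ₗ[R] (G.Face → R) where
  toFun c := fun f => ∑ e, c e * G.faceSign R f e
  map_add' a b := by ext v; simp [add_mul, Finset.sum_add_distrib]
  map_smul' r a := by ext v; simp [Finset.mul_sum, mul_assoc]

/-- The boundary of chains of dual faces, which correspond to the vertices. -/
noncomputable def cobdry₂ : (G.Vertex → R) →ₗ[R] (E → R) where
  toFun c := fun e => ∑ v, c v * G.vertexSign R v e
  map_add' a b := by ext e; simp [add_mul, Finset.sum_add_distrib]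
  map_smul' r a := by ext e; simp [Finset.mul_sum, mul_assoc]

end Chains

end PolygonDecomposition

/-- The algebraic number of crossings of a chain with a cochain. -/
def crossing {E R : Type*} [Fintype E] [CommRing R] (c s : E → R) : R := ∑ e, c e * s e

/-! ### Walks and cowalks -/

/-- Sequences of darts that match up, where a dart `a` leads from `s a` to `t a`. -/
inductive DartWalk {E A : Type*} (s t : Dart E → A) : A → A → Type _
  | nil (x : A) : DartWalk s t x x
  | cons {x y z : A} (a : Dart E) (hs : s a = x) (ht : t a = y) (p : DartWalk s t y z) :
      DartWalk s t x z

namespace DartWalk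

variable {E A : Type*} {s t : Dart E → A}

open Classical in
/-- The `1`-(co)chain of a (co)walk. -/
noncomputable def chain (R : Type*) [CommRing R] {x y : A} : DartWalk s t x y → (E → R)
  | nil _ => 0
  | cons a _ _ p => Pi.single a.1 (if a.2 = true then 1 else -1) + p.chain R

/-- The list of vertices (resp. faces) that a walk (resp. cowalk) visits. -/
def support {x y : A} : DartWalk s t x y → List A
  | nil x => [x]
  | cons (x := x) _ _ _ p => x :: p.support

end DartWalk

namespace PolygonDecomposition

variable {E : Type*} (G : PolygonDecomposition E)

abbrev Walk (v w : G.Vertex) := DartWalk G.src G.tgt v w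

/-- A step `a` of a cowalk runs through the dual edge of `a`, from the right of `a` to its left. -/
abbrev Cowalk (f g : G.Face) := DartWalk G.right G.left f g

end PolygonDecomposition

/-! ### The spin system -/

/-- `ω = exp(2πi/d)`. -/
noncomputable def omega (d : ℕ) : ℂ := Complex.exp (2 * Real.pi * Complex.I / d)

/-- `ω ^ a` for `a` in `ℤ/d`. -/
noncomputable def phase (d : ℕ) (a : ZMod d) : ℂ := omega d ^ a.val

theorem omega_pow_self (d : ℕ) [NeZero d] : omega d ^ d = 1 := by
  rw [omega, ← Complex.exp_nat_mul, mul_div_cancel₀ _ (Nat.cast_ne_zero.2 (NeZero.ne d)),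
    Complex.exp_two_pi_mul_I]

theorem phase_zero (d : ℕ) : phase d 0 = 1 := by simp [phase]

theorem phase_add (d : ℕ) [NeZero d] (a b : ZMod d) :
    phase d (a + b) = phase d a * phase d b := by
  rw [phase, phase, phase, ZMod.val_add, ← pow_add, ← pow_mod_orderOf,
    Nat.mod_mod_of_dvd _ (orderOf_dvd_of_pow_eq_one (omega_pow_self d)), pow_mod_orderOf]

section Operators

variable (E : Type*) [Fintype E] (d : ℕ)

/-- The tensor product over `e ∈ E` of the spaces `ℂ^d` with orthonormal bases `l_i`, `i ∈ ℤ/d`,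
written in the product basis `⨂ l_{k e}`, `k : E → ℤ/d`. -/
abbrev Hilb [NeZero d] := EuclideanSpace ℂ (E → ZMod d)

variable {E} [NeZero d]

/-- `X_{γ*} = ∏ X_e ^ {c_e}`, which maps `⨂ l_{k e}` to `⨂ l_{k e + c e}`. -/
def opX (c : E → ZMod d) : Hilb E d ≃ₗ[ℂ] Hilb E d where
  toFun ψ := WithLp.toLp 2 fun k => ψ (k - c)
  invFun ψ := WithLp.toLp 2 fun k => ψ (k + c)
  map_add' _ _ := by ext; simp
  map_smul' _ _ := by ext; simp
  left_inv _ := by ext; simp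
  right_inv _ := by ext; simp

/-- `Z_γ = ∏ Z_e ^ {c_e}`, which multiplies `⨂ l_{k e}` by `∏ ω ^ {c e * k e}`. -/
noncomputable def opZ (c : E → ZMod d) : Hilb E d ≃ₗ[ℂ] Hilb E d where
  toFun ψ := WithLp.toLp 2 fun k => phase d (∑ e, c e * k e) * ψ k
  invFun ψ := WithLp.toLp 2 fun k => phase d (-∑ e, c e * k e) * ψ k
  map_add' _ _ := by ext; simp [mul_add]
  map_smul' _ _ := by ext; simp [mul_left_comm]
  left_inv _ := by ext; simp [← mul_assoc, ← phase_add, phase_zero]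
  right_inv _ := by ext; simp [← mul_assoc, ← phase_add, phase_zero]

theorem opX_add (c c' : E → ZMod d) : opX d (c + c') = opX d c * opX d c' := by
  ext ψ k
  simp [opX, sub_sub]

theorem opZ_add (c c' : E → ZMod d) : opZ d (c + c') = opZ d c * opZ d c' := by
  ext ψ k
  simp [opZ, add_mul, Finset.sum_add_distrib, phase_add, mul_assoc]

/-- On the spin at a single edge, `X l_i = l_{i+1}`. -/
theorem opX_single [DecidableEq E] (e : E) (k : E → ZMod d) :
    opX d (Pi.single e 1) (EuclideanSpace.single k 1) =
      EuclideanSpace.single (k + Pi.single e 1) 1 := by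
  ext m
  simp [opX, sub_eq_iff_eq_add]

/-- On the spin at a single edge, `Z l_i = ω ^ i l_i`. -/
theorem opZ_single [DecidableEq E] (e : E) (k : E → ZMod d) :
    opZ d (Pi.single e 1) (EuclideanSpace.single k 1) =
      (omega d ^ (k e).val) • EuclideanSpace.single k (1 : ℂ) := by
  ext m
  by_cases h : m = k
  · subst h; simp [opZ, Pi.single_apply, phase]
  · simp [opZ, h]

end Operators

namespace PolygonDecomposition

variable {E : Type*} [Fintype E] (G : PolygonDecomposition E) (d : ℕ) [NeZero d]

/-- The product over the edges at `v` of `X_e` (incoming edges) and `X_e⁻¹` (outgoing edges). -/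
noncomputable def opa (v : G.Vertex) : Module.End ℂ (Hilb E d) :=
  (opX d (G.vertexSign (ZMod d) v)).toLinearMap

/-- The product over the edges of `f` of `Z_e` (positively oriented) and `Z_e⁻¹` (negatively). -/
noncomputable def opb (f : G.Face) : Module.End ℂ (Hilb E d) :=
  (opZ d (G.faceSign (ZMod d) f)).toLinearMap

noncomputable def opA (v : G.Vertex) : Module.End ℂ (Hilb E d) :=
  (d : ℂ)⁻¹ • ∑ j ∈ Finset.range d, G.opa d v ^ j

noncomputable def opB (f : G.Face) : Module.End ℂ (Hilb E d) :=
  (d : ℂ)⁻¹ • ∑ j ∈ Finset.range d, G.opb d f ^ j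

noncomputable def hamiltonian : Module.End ℂ (Hilb E d) :=
  -∑ v, G.opA d v - ∑ f, G.opB d f

/-- The smallest eigenvalue of the Hamiltonian. -/
noncomputable def groundEnergy : ℝ :=
  sInf {x : ℝ | (G.hamiltonian d).HasEigenvalue (x : ℂ)}

/-- The ground state space `S_G`. -/
noncomputable def groundSpace : Submodule ℂ (Hilb E d) :=
  (G.hamiltonian d).eigenspace (G.groundEnergy d : ℂ)

/-! ### Excited states and braiding -/

/-- The span of the states `X_{γ*} Z_γ Ψ`, over walks `γ` from `v` to `w` and cowalks `γ*` from `f`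
to `g`. -/
noncomputable def pairSpace (v w : G.Vertex) (f g : G.Face) (Ψ : Hilb E d) :
    Submodule ℂ (Hilb E d) :=
  Submodule.span ℂ
    {φ | ∃ (γ : G.Walk v w) (γs : G.Cowalk f g),
      φ = opX d (γs.chain (ZMod d)) (opZ d (γ.chain (ZMod d)) Ψ)}

/-- The closed walk `τ` at `v`, along which the `Z`-particle at `v` is transported around the
`X`-particle at `f`: it is a boundary and it has just one edge in common with the cowalk `γ*` from
`f` to `g`, where `γ*` crosses it from left to right. The latter says that `τ` encircles `f`
counterclockwise; as dual edges cross edges from right to left, it is expressed by the sign `-1`. -/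
structure IsBraidingLoop {v : G.Vertex} {f g : G.Face} (γs : G.Cowalk f g) (τ : G.Walk v v) :
    Prop where
  isBoundary : τ.chain (ZMod d) ∈ LinearMap.range (G.bdry₂ (ZMod d))
  crossesOnce : ∃ e : E, τ.chain (ZMod d) e * γs.chain (ZMod d) e = -1 ∧
    ∀ e' : E, τ.chain (ZMod d) e' ≠ 0 → γs.chain (ZMod d) e' ≠ 0 → e' = e

/-- The physical braiding: transport of the `Z`-particle along `τ`. -/
noncomputable def braiding {v : G.Vertex} (τ : G.Walk v v) : Hilb E d ≃ₗ[ℂ] Hilb E d :=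
  opZ d (τ.chain (ZMod d))

/-- Elementary cycles `lam`, `tau` that wind once around the torus in the two directions, and
corresponding elementary cocycles `lamS`, `tauS`. They are bases of the integral first homology of
the decomposition and of its dual, a cycle does not cross the parallel cocycle (algebraically), and
the cocycles are oriented so that they cross the transversal cycles in the positive direction. -/
structure ElementaryCycles where
  lam : E → ℤ
  tau : E → ℤ
  lamS : E → ℤ
  tauS : E → ℤ
  lam_cycle : G.bdry₁ ℤ lam = 0
  tau_cycle : G.bdry₁ ℤ tau = 0
  lamS_cocycle : G.cobdry₁ ℤ lamS = 0
  tauS_cocycle : G.cobdry₁ ℤ tauS = 0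
  basis : ∀ c : E → ℤ, G.bdry₁ ℤ c = 0 →
    ∃! m : ℤ × ℤ, c - (m.1 • lam + m.2 • tau) ∈ LinearMap.range (G.bdry₂ ℤ)
  cobasis : ∀ c : E → ℤ, G.cobdry₁ ℤ c = 0 →
    ∃! m : ℤ × ℤ, c - (m.1 • lamS + m.2 • tauS) ∈ LinearMap.range (G.cobdry₂ ℤ)
  lam_lamS : crossing lam lamS = 0
  tau_tauS : crossing tau tauS = 0
  lam_tauS : 0 < crossing lam tauS
  tau_lamS : 0 < crossing tau lamS

variable {G}

/-- The `1`-chain `c` is a cycle with homology class `(α, β)`, i.e. it is homologous modulo `d` to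
`α lam + β tau`. -/
def ElementaryCycles.HasClass (M : G.ElementaryCycles) (c : E → ZMod d) (α β : ZMod d) : Prop :=
  (c - fun e => α * (M.lam e : ZMod d) + β * (M.tau e : ZMod d)) ∈
    LinearMap.range (G.bdry₂ (ZMod d))

/-- The `1`-cochain `c` is a cocycle with cohomology class `(α, β)`. -/
def ElementaryCycles.HasCoclass (M : G.ElementaryCycles) (c : E → ZMod d) (α β : ZMod d) : Prop :=
  (c - fun e => α * (M.lamS e : ZMod d) + β * (M.tauS e : ZMod d)) ∈
    LinearMap.range (G.cobdry₂ (ZMod d))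

end PolygonDecomposition

end Kitaev

/-!
The terms `A_v` and `B_f` of the Hamiltonian are averages of the powers of unitaries of order `d`
and have a common fixed vector, so the ground states are exactly the common fixed vectors. As
functions of `k : E → ℤ/d` these are supported on cocycles and invariant under coboundaries: they
are the functions on the first cohomology.

The operators `X_k Z_c`, for cocycles `k` and cycles `c`, act irreducibly on them. Averaging over
the cycles projects a ground state to a single cohomology class, and cocycles move this class to
any other one. Since two walks between the same vertices differ by a cycle, and likewise for
cowalks, the span of the excited states is the image of the whole ground state space.

Moving `Z_c` past `X_k` costs the phase `ω ^ ⟨c, k⟩`. A braiding loop acts trivially on ground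
states and crosses the cowalk with total sign `-1`, so its action is `ω⁻¹`. The commutator of the
global loop operators is `ω ^ (-⟨tau, lamS⟩)`, and Poincaré duality makes this crossing number `1`.
-/

namespace Kitaev

/-! ### Homology of graphs given by darts -/

theorem crossing_eq_dotProduct {E R : Type*} [Fintype E] [CommRing R] (c k : E → R) :
    crossing c k = c ⬝ᵥ k := rfl

theorem flip_flip {E : Type*} (a : Dart E) : flip E (flip E a) = a := by
  rcases a with ⟨e, _ | _⟩ <;> rfl

section Incidence

variable {E A : Type*} (s t : Dart E → A) (R : Type*) [CommRing R]

open Classical in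
/-- The incidence matrix of the graph in which the edge `e` leads from `s (e, true)` to
`t (e, true)`. -/
noncomputable def incidenceMatrix : Matrix E A R :=
  .of fun e x => (if t (e, true) = x then 1 else 0) - (if s (e, true) = x then 1 else 0)

/-- The boundary map of a graph, from `1`-chains to `0`-chains. -/
noncomputable def boundary [Fintype E] : (E → R) →ₗ[R] (A → R) :=
  (incidenceMatrix s t R).vecMulLinear

/-- The coboundary map of a graph, from functions on the vertices to functions on the edges. -/
def coboundary : (A → R) →ₗ[R] (E → R) :=
  LinearMap.funLeft R R (fun e => t (e, true)) - LinearMap.funLeft R R (fun e => s (e, true))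

variable {s t R}

theorem coboundary_apply (p : A → R) (e : E) :
    coboundary s t R p e = p (t (e, true)) - p (s (e, true)) := rfl

variable [Fintype E]

theorem boundary_apply (c : E → R) (x : A) :
    boundary s t R c x = ∑ e, c e * incidenceMatrix s t R e x := rfl

open Classical in
theorem boundary_single (e : E) (r : R) :
    boundary s t R (Pi.single e r) = Pi.single (t (e, true)) r - Pi.single (s (e, true)) r := by
  ext x
  simp [boundary, incidenceMatrix, mul_sub, Pi.single_apply, eq_comm]

theorem sum_boundary_smul [Fintype A] {M : Type*} [AddCommGroup M] [Module R M] (c : E → R)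
    (P : A → M) :
    ∑ x, boundary s t R c x • P x = ∑ e, c e • (P (t (e, true)) - P (s (e, true))) := by
  classical
  simp only [boundary_apply, incidenceMatrix, Matrix.of_apply, Finset.sum_smul]
  rw [Finset.sum_comm]
  refine Finset.sum_congr rfl fun e _ => ?_
  simp only [mul_smul, ← Finset.smul_sum, sub_smul, Finset.sum_sub_distrib]
  simp [ite_smul]

theorem dotProduct_coboundary [Fintype A] (c : E → R) (p : A → R) :
    c ⬝ᵥ coboundary s t R p = boundary s t R c ⬝ᵥ p :=
  (sum_boundary_smul c p).symm

theorem boundary_map {S : Type*} [CommRing S] (φ : R →+* S) (c : E → R) :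
    boundary s t S (φ ∘ c) = φ ∘ boundary s t R c := by
  ext x
  simp [boundary_apply, incidenceMatrix, apply_ite φ]

end Incidence

namespace DartWalk

variable {E A : Type*} {s t : Dart E → A}

/-- Concatenation of walks. -/
def append {x y z : A} : DartWalk s t x y → DartWalk s t y z → DartWalk s t x z
  | nil _, q => q
  | cons a hs ht p, q => cons a hs ht (p.append q)

/-- The walk that runs through all darts in the opposite direction and order. -/
def reverse (h : ∀ a, s (flip E a) = t a) {x y : A} : DartWalk s t x y → DartWalk s t y x
  | nil x => nil x
  | cons a hs ht p => (p.reverse h).append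
      (cons (flip E a) ((h a).trans ht) (by rw [← h, flip_flip, hs]) (nil _))

variable (R : Type*) [CommRing R]

theorem chain_append {x y z : A} (p : DartWalk s t x y) (q : DartWalk s t y z) :
    (p.append q).chain R = p.chain R + q.chain R := by
  induction p with
  | nil => simp [append, chain]
  | cons a hs ht p ih => simp [append, chain, ih, add_assoc]

theorem chain_reverse (h : ∀ a, s (flip E a) = t a) {x y : A} (p : DartWalk s t x y) :
    (p.reverse h).chain R = -p.chain R := by
  induction p with
  | nil => simp [reverse, chain]
  | cons a hs ht p ih =>
    rcases a with ⟨e, _ | _⟩ <;> simp [reverse, chain_append, ih, chain, flip, Pi.single_neg]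

open Classical in
theorem boundary_chain [Fintype E] (h : ∀ a, s (flip E a) = t a) {x y : A}
    (p : DartWalk s t x y) :
    boundary s t R (p.chain R) = Pi.single y 1 - Pi.single x 1 := by
  induction p with
  | nil => simp [chain]
  | cons a hs ht p ih =>
    subst hs ht
    rw [chain, map_add, ih, boundary_single]
    rcases a with ⟨e, _ | _⟩
    · have h_src : s (e, false) = t (e, true) := h (e, true)
      have h_tgt : s (e, true) = t (e, false) := h (e, false)
      rw [h_src, h_tgt, if_neg Bool.false_ne_true, Pi.single_neg, Pi.single_neg]
      abel
    · simp

/-- The group of the chains of the closed walks at `x`. -/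
def closedChains (h : ∀ a, s (flip E a) = t a) (x : A) : AddSubgroup (E → R) where
  carrier := Set.range fun p : DartWalk s t x x => p.chain R
  zero_mem' := ⟨nil x, rfl⟩
  add_mem' := by
    rintro _ _ ⟨p, rfl⟩ ⟨q, rfl⟩
    exact ⟨p.append q, chain_append R p q⟩
  neg_mem' := by
    rintro _ ⟨p, rfl⟩
    exact ⟨p.reverse h, chain_reverse R h p⟩

end DartWalk

theorem finrank_range_add_finrank_ker {R M N : Type*} [CommRing R] [IsDomain R]
    [AddCommGroup M] [Module R M] [Module.Finite R M] [AddCommGroup N] [Module R N]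
    (φ : M →ₗ[R] N) :
    Module.finrank R (LinearMap.range φ) + Module.finrank R (LinearMap.ker φ) =
      Module.finrank R M := by
  rw [← φ.quotKerEquivRange.finrank_eq, Submodule.finrank_quotient_add_finrank]

/-- The darts with initial vertices `s` and final vertices `t` form a connected graph. -/
structure IsConnectedGraph {E A : Type*} (s t : Dart E → A) : Prop where
  src_flip : ∀ a, s (flip E a) = t a
  nonempty : Nonempty A
  reachable : ∀ x y, Nonempty (DartWalk s t x y)

namespace IsConnectedGraph

variable {E A : Type*} {s t : Dart E → A} (R : Type*) [CommRing R]

/-- The chain of a chosen path from a base point to `x`. -/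
noncomputable def pathChain (h : IsConnectedGraph s t) (x₀ x : A) : E → R :=
  (h.reachable x₀ x).some.chain R

open Classical in
/-- The chain of the loop from the base point to the start of `e`, through `e`, and back. -/
noncomputable def loop (h : IsConnectedGraph s t) (x₀ : A) (e : E) : E → R :=
  h.pathChain R x₀ (s (e, true)) + Pi.single e 1 - h.pathChain R x₀ (t (e, true))

theorem loop_mem_closedChains (h : IsConnectedGraph s t) (x₀ : A) (e : E) :
    h.loop R x₀ e ∈ DartWalk.closedChains R h.src_flip x₀ := by
  let there := (h.reachable x₀ (s (e, true))).some
  let back := (h.reachable x₀ (t (e, true))).some.reverse h.src_flip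
  refine ⟨(there.append (.cons (e, true) rfl rfl (.nil _))).append back, ?_⟩
  simp [there, back, DartWalk.chain_append, DartWalk.chain_reverse, DartWalk.chain, loop,
    pathChain, sub_eq_add_neg]

section Cycles

variable {R} [Fintype E]

theorem boundary_loop (h : IsConnectedGraph s t) (x₀ : A) (e : E) :
    boundary s t R (h.loop R x₀ e) = 0 := by
  obtain ⟨p, hp⟩ := h.loop_mem_closedChains R x₀ e
  rw [← hp, DartWalk.boundary_chain R h.src_flip, sub_self]

variable [Finite A]

theorem sum_smul_loop (h : IsConnectedGraph s t) (x₀ : A) {c : E → R}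
    (hc : boundary s t R c = 0) : ∑ e, c e • h.loop R x₀ e = c := by
  classical
  cases nonempty_fintype A
  have h_paths : ∑ e, c e • (h.pathChain R x₀ (t (e, true)) - h.pathChain R x₀ (s (e, true))) =
      0 := by
    rw [← sum_boundary_smul, hc]
    simp
  have h_edges : ∑ e, c e • (Pi.single e 1 : E → R) = c := (pi_eq_sum_univ' c).symm
  calc ∑ e, c e • h.loop R x₀ e
      = ∑ e, (c e • (Pi.single e 1 : E → R) -
          c e • (h.pathChain R x₀ (t (e, true)) - h.pathChain R x₀ (s (e, true)))) :=
        Finset.sum_congr rfl fun e _ => by rw [loop, ← smul_sub]; congr 1; abel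
    _ = c := by rw [Finset.sum_sub_distrib, h_paths, h_edges, sub_zero]

theorem exists_closedWalk {d : ℕ} (h : IsConnectedGraph s t) (x : A) {c : E → ZMod d}
    (hc : boundary s t (ZMod d) c = 0) : ∃ p : DartWalk s t x x, p.chain (ZMod d) = c := by
  suffices c ∈ AddSubgroup.toZModSubmodule d (DartWalk.closedChains (ZMod d) h.src_flip x) from
    this
  rw [← h.sum_smul_loop x hc]
  exact sum_mem fun e _ => Submodule.smul_mem _ _ (h.loop_mem_closedChains (ZMod d) x e)

theorem exists_walk_chain {d : ℕ} (h : IsConnectedGraph s t) {x y : A} (p : DartWalk s t x y)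
    {c : E → ZMod d} (hc : boundary s t (ZMod d) c = 0) :
    ∃ q : DartWalk s t x y, q.chain (ZMod d) = c + p.chain (ZMod d) := by
  obtain ⟨q, rfl⟩ := h.exists_closedWalk x hc
  exact ⟨q.append p, DartWalk.chain_append _ q p⟩

theorem mem_range_coboundary_iff (h : IsConnectedGraph s t) {k : E → R} :
    k ∈ LinearMap.range (coboundary s t R) ↔ ∀ c, boundary s t R c = 0 → c ⬝ᵥ k = 0 := by
  classical
  cases nonempty_fintype A
  constructor
  · rintro ⟨p, rfl⟩ c hc
    rw [dotProduct_coboundary, hc, zero_dotProduct]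
  · intro hk
    obtain ⟨x₀⟩ := h.nonempty
    refine ⟨fun x => h.pathChain R x₀ x ⬝ᵥ k, funext fun e => ?_⟩
    have h_loop := hk _ (h.boundary_loop x₀ e)
    rw [loop, sub_dotProduct, add_dotProduct, single_one_dotProduct] at h_loop
    rw [coboundary_apply]
    linear_combination -h_loop

end Cycles

section Rank

theorem ker_coboundary (h : IsConnectedGraph s t) :
    LinearMap.ker (coboundary s t R) = Submodule.span R {1} := by
  ext p
  rw [LinearMap.mem_ker, Submodule.mem_span_singleton]
  constructor
  · intro hp
    have h_edge : ∀ e, p (t (e, true)) = p (s (e, true)) := fun e => sub_eq_zero.1 (congrFun hp e)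
    have h_dart : ∀ a, p (t a) = p (s a) := by
      rintro ⟨e, _ | _⟩
      · rw [← h.src_flip, show s (e, false) = t (e, true) from h.src_flip (e, true)]
        exact (h_edge e).symm
      · exact h_edge e
    have h_walk : ∀ {x y}, DartWalk s t x y → p y = p x := fun q => by
      induction q with
      | nil => rfl
      | cons a hs ht q ih => rw [ih, ← hs, ← ht, h_dart]
    obtain ⟨x₀⟩ := h.nonempty
    exact ⟨p x₀, funext fun x => by simpa using (h_walk (h.reachable x₀ x).some).symm⟩
  · rintro ⟨r, rfl⟩
    ext e
    simp [coboundary_apply]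

theorem range_boundary [Fintype E] [Fintype A] (h : IsConnectedGraph s t) :
    LinearMap.range (boundary s t R) = LinearMap.ker (Fintype.linearCombination R (1 : A → R)) := by
  classical
  ext p
  have h_sum : Fintype.linearCombination R (1 : A → R) p = ∑ x, p x := by
    simp [Fintype.linearCombination_apply]
  rw [LinearMap.mem_ker, h_sum]
  constructor
  · rintro ⟨c, rfl⟩
    simpa using sum_boundary_smul (s := s) (t := t) c (fun _ => (1 : R))
  · intro hp
    obtain ⟨x₀⟩ := h.nonempty
    refine ⟨∑ x, p x • h.pathChain R x₀ x, ?_⟩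
    simp only [map_sum, map_smul, pathChain, DartWalk.boundary_chain R h.src_flip, smul_sub,
      Finset.sum_sub_distrib, ← Finset.sum_smul, hp, zero_smul, sub_zero]
    exact (pi_eq_sum_univ' p).symm

variable [IsDomain R]

theorem finrank_range_coboundary [Fintype A] (h : IsConnectedGraph s t) :
    Module.finrank R (LinearMap.range (coboundary s t R)) + 1 = Fintype.card A := by
  obtain ⟨x₀⟩ := h.nonempty
  have h_ker : Module.finrank R (LinearMap.ker (coboundary s t R)) = 1 := by
    rw [h.ker_coboundary R, ← (LinearEquiv.toSpanNonzeroSingleton R (A → R) 1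
      fun h_one => one_ne_zero (congrFun h_one x₀)).finrank_eq, Module.finrank_self]
  rw [← Module.finrank_fintype_fun_eq_card R, ← finrank_range_add_finrank_ker (coboundary s t R),
    h_ker]

theorem finrank_range_boundary [Fintype E] [Fintype A] (h : IsConnectedGraph s t) :
    Module.finrank R (LinearMap.range (boundary s t R)) + 1 = Fintype.card A := by
  classical
  obtain ⟨x₀⟩ := h.nonempty
  have h_surjective : LinearMap.range (Fintype.linearCombination R (1 : A → R)) = ⊤ :=
    LinearMap.range_eq_top.2 fun r => ⟨Pi.single x₀ r, by simp [Fintype.linearCombination_apply]⟩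
  rw [← Module.finrank_fintype_fun_eq_card R,
    ← finrank_range_add_finrank_ker (Fintype.linearCombination R (1 : A → R)), h_surjective,
    finrank_top, Module.finrank_self, h.range_boundary R, add_comm]

end Rank

end IsConnectedGraph

/-! ### The graph and the dual graph of a polygon decomposition -/

namespace PolygonDecomposition

variable {E : Type*} (G : PolygonDecomposition E)

theorem rotation_faceRotation (a : Dart E) : G.rotation (G.faceRotation a) = flip E a := by
  simp [faceRotation]

theorem src_rotation (a : Dart E) : G.src (G.rotation a) = G.src a :=
  Quotient.sound ((Equiv.Perm.SameCycle.refl _ _).apply_left)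

theorem left_faceRotation (a : Dart E) : G.left (G.faceRotation a) = G.left a :=
  Quotient.sound ((Equiv.Perm.SameCycle.refl _ _).apply_left)

theorem src_faceRotation (a : Dart E) : G.src (G.faceRotation a) = G.tgt a := by
  rw [← src_rotation, rotation_faceRotation, tgt]

theorem right_flip (a : Dart E) : G.right (flip E a) = G.left a := by
  rw [right, flip_flip]

theorem rel_of_rel_rotation_of_rel_flip {r : Dart E → Dart E → Prop} (hr : Equivalence r)
    (h_rotation : ∀ a, r a (G.rotation a)) (h_flip : ∀ a, r a (flip E a)) (a b : Dart E) :
    r a b := by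
  obtain ⟨⟨π, hπ⟩, rfl⟩ := G.connected.exists_smul_eq a b
  suffices ∀ a, r a (π a) from this a
  induction hπ using Subgroup.closure_induction with
  | mem π hπ =>
    rcases hπ with rfl | rfl
    · exact h_rotation
    · exact h_flip
  | one => exact hr.refl
  | mul π ρ _ _ hπ hρ => exact fun a => hr.trans (hρ a) (hπ (ρ a))
  | inv π _ hπ => exact fun a => hr.symm (by simpa using hπ (π⁻¹ a))

theorem walk_isConnectedGraph : IsConnectedGraph G.src G.tgt where
  src_flip _ := rfl
  nonempty := ⟨G.src (G.nonempty.some, true)⟩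
  reachable := by
    rintro ⟨a⟩ ⟨b⟩
    refine G.rel_of_rel_rotation_of_rel_flip (r := fun a b => Nonempty (G.Walk (G.src a) (G.src b)))
      ⟨fun _ => ⟨.nil _⟩, fun ⟨p⟩ => ⟨p.reverse fun _ => rfl⟩, fun ⟨p⟩ ⟨q⟩ => ⟨p.append q⟩⟩
      (fun a => ?_) (fun a => ⟨.cons a rfl rfl (.nil _)⟩) a b
    rw [src_rotation]
    exact ⟨.nil _⟩

theorem cowalk_isConnectedGraph : IsConnectedGraph G.right G.left where
  src_flip := G.right_flip
  nonempty := ⟨G.left (G.nonempty.some, true)⟩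
  reachable := by
    have h_flip (a) : Nonempty (G.Cowalk (G.left a) (G.left (flip E a))) :=
      ⟨.cons (flip E a) (G.right_flip a) rfl (.nil _)⟩
    rintro ⟨a⟩ ⟨b⟩
    refine G.rel_of_rel_rotation_of_rel_flip
      (r := fun a b => Nonempty (G.Cowalk (G.left a) (G.left b)))
      ⟨fun _ => ⟨.nil _⟩, fun ⟨p⟩ => ⟨p.reverse G.right_flip⟩, fun ⟨p⟩ ⟨q⟩ => ⟨p.append q⟩⟩
      (fun a => ?_) h_flip a b
    obtain ⟨a, rfl⟩ := G.faceRotation.surjective a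
    rw [left_faceRotation, rotation_faceRotation]
    exact h_flip a

variable [Fintype E]

section Complex

variable (R : Type*) [CommRing R]

theorem bdry₁_eq_boundary : G.bdry₁ R = boundary G.src G.tgt R := rfl

theorem cobdry₁_eq_boundary : G.cobdry₁ R = boundary G.right G.left R := rfl

theorem bdry₂_eq_coboundary : G.bdry₂ R = coboundary G.right G.left R := by
  classical
  refine LinearMap.ext fun p => funext fun e => ?_
  simp [bdry₂, faceSign, coboundary_apply, mul_sub]

theorem cobdry₂_eq_coboundary : G.cobdry₂ R = coboundary G.src G.tgt R := by
  classical
  refine LinearMap.ext fun p => funext fun e => ?_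
  simp [cobdry₂, vertexSign, coboundary_apply, mul_sub]

theorem faceSign_dotProduct_vertexSign (f : G.Face) (v : G.Vertex) :
    G.faceSign R f ⬝ᵥ G.vertexSign R v = 0 := by
  classical
  let onLeft (a : Dart E) : R := if G.left a = f then 1 else 0
  let atSrc (a : Dart E) : R := if G.src a = v then 1 else 0
  -- Each edge collects the contributions of its two darts; along the boundary of `f` the end of
  -- a dart is the start of the next one, so that the sum telescopes.
  calc G.faceSign R f ⬝ᵥ G.vertexSign R v
      = ∑ e, ∑ b, onLeft (e, b) * (atSrc (flip E (e, b)) - atSrc (e, b)) := by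
        refine Finset.sum_congr rfl fun e _ => ?_
        rw [Fintype.sum_bool]
        change (onLeft (e, true) - onLeft (e, false)) * (atSrc (e, false) - atSrc (e, true)) =
          onLeft (e, true) * (atSrc (e, false) - atSrc (e, true)) +
            onLeft (e, false) * (atSrc (e, true) - atSrc (e, false))
        ring
    _ = ∑ a, onLeft a * (atSrc (flip E a) - atSrc a) := by
        rw [Fintype.sum_prod_type]
    _ = ∑ a, onLeft (G.faceRotation a) * atSrc (G.faceRotation a) - ∑ a, onLeft a * atSrc a := by
        simp only [onLeft, atSrc, left_faceRotation, src_faceRotation, mul_sub,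
          Finset.sum_sub_distrib, tgt]
    _ = 0 := by
        rw [Equiv.sum_comp G.faceRotation fun a => onLeft a * atSrc a, sub_self]

variable {R}

theorem bdry₂_single [DecidableEq G.Face] (f : G.Face) :
    G.bdry₂ R (Pi.single f 1) = G.faceSign R f := by
  ext e
  simp [bdry₂, Pi.single_apply]

theorem cobdry₂_single [DecidableEq G.Vertex] (v : G.Vertex) :
    G.cobdry₂ R (Pi.single v 1) = G.vertexSign R v := by
  ext e
  simp [cobdry₂, Pi.single_apply]

theorem bdry₂_eq_sum (p : G.Face → R) : G.bdry₂ R p = ∑ f, p f • G.faceSign R f := by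
  ext e
  simp [bdry₂, Finset.sum_apply]

theorem cobdry₂_eq_sum (p : G.Vertex → R) : G.cobdry₂ R p = ∑ v, p v • G.vertexSign R v := by
  ext e
  simp [cobdry₂, Finset.sum_apply]

theorem bdry₁_bdry₂ (p : G.Face → R) : G.bdry₁ R (G.bdry₂ R p) = 0 := by
  have h_face (f) : G.bdry₁ R (G.faceSign R f) = 0 :=
    funext fun v => G.faceSign_dotProduct_vertexSign R f v
  simp [bdry₂_eq_sum, h_face]

theorem cobdry₁_cobdry₂ (p : G.Vertex → R) : G.cobdry₁ R (G.cobdry₂ R p) = 0 := by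
  have h_vertex (v) : G.cobdry₁ R (G.vertexSign R v) = 0 :=
    funext fun f => (dotProduct_comm _ _).trans (G.faceSign_dotProduct_vertexSign R f v)
  simp [cobdry₂_eq_sum, h_vertex]

variable (R)

/-- The module of `1`-cycles. -/
noncomputable abbrev cycles : Submodule R (E → R) := LinearMap.ker (G.bdry₁ R)

/-- The module of boundaries of `2`-chains. -/
noncomputable abbrev boundaries : Submodule R (E → R) := LinearMap.range (G.bdry₂ R)

/-- The module of `1`-cocycles, i.e. cycles of the dual decomposition. -/
noncomputable abbrev cocycles : Submodule R (E → R) := LinearMap.ker (G.cobdry₁ R)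

/-- The module of coboundaries, i.e. boundaries in the dual decomposition. -/
noncomputable abbrev coboundaries : Submodule R (E → R) := LinearMap.range (G.cobdry₂ R)

theorem boundaries_le_cycles : G.boundaries R ≤ G.cycles R := by
  rintro _ ⟨p, rfl⟩
  exact G.bdry₁_bdry₂ p

theorem coboundaries_le_cocycles : G.coboundaries R ≤ G.cocycles R := by
  rintro _ ⟨p, rfl⟩
  exact G.cobdry₁_cobdry₂ p

variable {R}

theorem mem_boundaries_iff {c : E → R} :
    c ∈ G.boundaries R ↔ ∀ k ∈ G.cocycles R, c ⬝ᵥ k = 0 := by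
  rw [boundaries, bdry₂_eq_coboundary, G.cowalk_isConnectedGraph.mem_range_coboundary_iff]
  exact forall₂_congr fun k _ => by rw [dotProduct_comm]

theorem mem_coboundaries_iff {k : E → R} :
    k ∈ G.coboundaries R ↔ ∀ c ∈ G.cycles R, c ⬝ᵥ k = 0 := by
  rw [coboundaries, cobdry₂_eq_coboundary, G.walk_isConnectedGraph.mem_range_coboundary_iff]
  rfl

end Complex

/-! ### Homology and Poincaré duality -/

section Homology

variable (R : Type*) [CommRing R]

/-- The first homology of the surface with coefficients in `R`. -/
abbrev Homology : Type _ := G.cycles R ⧸ (G.boundaries R).submoduleOf (G.cycles R)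

/-- The homology class of a cycle. -/
noncomputable abbrev homologyClass : G.cycles R →ₗ[R] G.Homology R := Submodule.mkQ _

variable {R}

theorem homologyClass_eq_zero_iff {c : G.cycles R} :
    G.homologyClass R c = 0 ↔ (c : E → R) ∈ G.boundaries R :=
  Submodule.Quotient.mk_eq_zero _

theorem exists_cocycle_of_functional (φ : G.Homology R →ₗ[R] R) :
    ∃ k ∈ G.cocycles R, ∀ c : G.cycles R, (c : E → R) ⬝ᵥ k = φ (G.homologyClass R c) := by
  classical
  have h := G.walk_isConnectedGraph
  obtain ⟨x₀⟩ := h.nonempty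
  let loopCycle (e : E) : G.cycles R := ⟨h.loop R x₀ e, h.boundary_loop x₀ e⟩
  let k (e : E) : R := φ (G.homologyClass R (loopCycle e))
  have h_pairing (c : G.cycles R) : (c : E → R) ⬝ᵥ k = φ (G.homologyClass R c) := by
    have h_loops : c = ∑ e, (c : E → R) e • loopCycle e := by
      ext1
      rw [AddSubmonoidClass.coe_finsetSum]
      exact (h.sum_smul_loop x₀ c.2).symm
    conv_rhs => rw [h_loops, map_sum, map_sum]
    simp only [map_smul]
    rfl
  refine ⟨k, funext fun f => ?_, h_pairing⟩
  have h_face : G.faceSign R f ∈ G.boundaries R := ⟨Pi.single f 1, G.bdry₂_single f⟩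
  calc G.cobdry₁ R k f = G.faceSign R f ⬝ᵥ k := dotProduct_comm _ _
    _ = φ (G.homologyClass R ⟨G.faceSign R f, G.boundaries_le_cycles R h_face⟩) :=
      h_pairing ⟨_, G.boundaries_le_cycles R h_face⟩
    _ = 0 := by rw [G.homologyClass_eq_zero_iff.2 h_face, map_zero]

variable (R) [IsDomain R]

instance isTorsionFree_homology : Module.IsTorsionFree R (G.Homology R) := by
  refine .of_smul_eq_zero fun r x hrx => or_iff_not_imp_left.2 fun hr => ?_
  obtain ⟨c, rfl⟩ := Submodule.mkQ_surjective _ x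
  rw [← map_smul, homologyClass_eq_zero_iff, mem_boundaries_iff] at hrx
  rw [homologyClass_eq_zero_iff, mem_boundaries_iff]
  intro k hk
  have h_smul : r * ((c : E → R) ⬝ᵥ k) = 0 :=
    (smul_dotProduct r (c : E → R) k).symm.trans (hrx k hk)
  exact (mul_eq_zero.1 h_smul).resolve_left hr

theorem finrank_homology [IsNoetherianRing R] {g : ℕ} (hG : G.HasGenus g) :
    Module.finrank R (G.Homology R) = 2 * g := by
  have h_bdry₁ : Module.finrank R (LinearMap.range (G.bdry₁ R)) + 1 = Fintype.card G.Vertex :=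
    G.walk_isConnectedGraph.finrank_range_boundary R
  have h_boundaries : Module.finrank R (G.boundaries R) + 1 = Fintype.card G.Face := by
    rw [boundaries, bdry₂_eq_coboundary]
    exact G.cowalk_isConnectedGraph.finrank_range_coboundary R
  have h_cycles : Module.finrank R (LinearMap.range (G.bdry₁ R)) +
      Module.finrank R (G.cycles R) = Fintype.card E :=
    (finrank_range_add_finrank_ker _).trans (Module.finrank_fintype_fun_eq_card R)
  have h_quotient : Module.finrank R (G.Homology R) + Module.finrank R (G.boundaries R) =
      Module.finrank R (G.cycles R) := by
    rw [← (Submodule.submoduleOfEquivOfLe (G.boundaries_le_cycles R)).finrank_eq]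
    exact Submodule.finrank_quotient_add_finrank _
  rw [HasGenus, Nat.card_eq_fintype_card, Nat.card_eq_fintype_card, Nat.card_eq_fintype_card] at hG
  omega

end Homology

/-- Cycles and cocycles that represent a basis of the homology and the dual basis of the
cohomology, with respect to the crossing numbers. -/
structure DualBases (R ι : Type*) [CommRing R] [Fintype ι] [DecidableEq ι] where
  cycle : ι → E → R
  cocycle : ι → E → R
  cycle_mem : ∀ i, cycle i ∈ G.cycles R
  cocycle_mem : ∀ i, cocycle i ∈ G.cocycles R
  cycle_dotProduct_cocycle : ∀ i j, cycle i ⬝ᵥ cocycle j = if i = j then 1 else 0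
  sub_sum_mem_boundaries : ∀ c ∈ G.cycles R,
    c - ∑ i, (c ⬝ᵥ cocycle i) • cycle i ∈ G.boundaries R

variable {G}

namespace DualBases

variable {R ι : Type*} [CommRing R] [Fintype ι] [DecidableEq ι] (D : G.DualBases R ι)

theorem sub_sum_mem_boundaries_iff {c : E → R} (hc : c ∈ G.cycles R) {m : ι → R} :
    c - ∑ i, m i • D.cycle i ∈ G.boundaries R ↔ m = fun i => c ⬝ᵥ D.cocycle i := by
  refine ⟨fun hm => funext fun j => ?_, fun hm => hm ▸ D.sub_sum_mem_boundaries c hc⟩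
  have h_pairing := G.mem_boundaries_iff.1 hm _ (D.cocycle_mem j)
  simp only [sub_dotProduct, sum_dotProduct, smul_dotProduct, D.cycle_dotProduct_cocycle]
    at h_pairing
  simpa [sub_eq_zero, eq_comm (b := m j)] using h_pairing

theorem sub_sum_mem_coboundaries_iff {k : E → R} (hk : k ∈ G.cocycles R) {m : ι → R} :
    k - ∑ i, m i • D.cocycle i ∈ G.coboundaries R ↔ m = fun i => D.cycle i ⬝ᵥ k := by
  constructor
  · refine fun hm => funext fun j => ?_
    have h_pairing := G.mem_coboundaries_iff.1 hm _ (D.cycle_mem j)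
    simp only [dotProduct_sub, dotProduct_sum, dotProduct_smul, D.cycle_dotProduct_cocycle]
      at h_pairing
    simpa [sub_eq_zero, eq_comm (b := m j), eq_comm (b := j)] using h_pairing
  · rintro rfl
    refine G.mem_coboundaries_iff.2 fun c hc => ?_
    have h_pairing := G.mem_boundaries_iff.1 (D.sub_sum_mem_boundaries c hc) k hk
    simp only [sub_dotProduct, sum_dotProduct, smul_dotProduct] at h_pairing
    simpa only [dotProduct_sub, dotProduct_sum, dotProduct_smul, smul_eq_mul, mul_comm]
      using h_pairing

end DualBases

theorem nonempty_dualBases (R : Type*) [CommRing R] [IsDomain R] [IsPrincipalIdealRing R] {g : ℕ}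
    (hG : G.HasGenus g) : Nonempty (G.DualBases R (Fin (2 * g))) := by
  let b : Module.Basis (Fin (2 * g)) R (G.Homology R) :=
    Module.finBasisOfFinrankEq R _ (G.finrank_homology R hG)
  choose z hz using fun i => Submodule.mkQ_surjective _ (b i)
  choose k hk_mem hk using fun i => G.exists_cocycle_of_functional (b.coord i)
  refine ⟨⟨fun i => z i, k, fun i => (z i).2, hk_mem, fun i j => ?_, fun c hc => ?_⟩⟩
  · rw [hk, homologyClass, hz, b.coord_apply, b.repr_self, Finsupp.single_apply]
  · have h_class : G.homologyClass R (⟨c, hc⟩ - ∑ i, (c ⬝ᵥ k i) • z i) = 0 := by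
      rw [map_sub, map_sum, sub_eq_zero]
      conv_lhs => rw [← b.sum_repr (G.homologyClass R ⟨c, hc⟩)]
      refine Finset.sum_congr rfl fun i _ => ?_
      rw [map_smul, homologyClass, hz, ← b.coord_apply, ← hk i ⟨c, hc⟩]
    simpa using G.homologyClass_eq_zero_iff.1 h_class

/-! ### Elementary cycles -/

theorem nonempty_elementaryCycles (hG : G.HasGenus 1) : Nonempty G.ElementaryCycles := by
  obtain ⟨D⟩ := nonempty_dualBases ℤ hG
  have h_cycle {c : E → ℤ} (hc : c ∈ G.cycles ℤ) (m : ℤ × ℤ) :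
      c - (m.1 • D.cycle 0 + m.2 • D.cycle 1) ∈ G.boundaries ℤ ↔
        m = (c ⬝ᵥ D.cocycle 0, c ⬝ᵥ D.cocycle 1) := by
    simpa [Fin.sum_univ_two, funext_iff, Fin.forall_fin_two, Prod.ext_iff] using
      D.sub_sum_mem_boundaries_iff hc (m := ![m.1, m.2])
  have h_cocycle {k : E → ℤ} (hk : k ∈ G.cocycles ℤ) (m : ℤ × ℤ) :
      k - (m.1 • D.cocycle 1 + m.2 • D.cocycle 0) ∈ G.coboundaries ℤ ↔
        m = (D.cycle 1 ⬝ᵥ k, D.cycle 0 ⬝ᵥ k) := by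
    simpa [Fin.sum_univ_two, funext_iff, Fin.forall_fin_two, Prod.ext_iff, add_comm, and_comm]
      using D.sub_sum_mem_coboundaries_iff hk (m := ![m.2, m.1])
  exact ⟨{
    lam := D.cycle 0
    tau := D.cycle 1
    lamS := D.cocycle 1
    tauS := D.cocycle 0
    lam_cycle := D.cycle_mem 0
    tau_cycle := D.cycle_mem 1
    lamS_cocycle := D.cocycle_mem 1
    tauS_cocycle := D.cocycle_mem 0
    basis := fun c hc => ⟨_, (h_cycle hc _).2 rfl, fun m hm => (h_cycle hc m).1 hm⟩
    cobasis := fun k hk => ⟨_, (h_cocycle hk _).2 rfl, fun m hm => (h_cocycle hk m).1 hm⟩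
    lam_lamS := by simp [crossing_eq_dotProduct, D.cycle_dotProduct_cocycle]
    tau_tauS := by simp [crossing_eq_dotProduct, D.cycle_dotProduct_cocycle]
    lam_tauS := by simp [crossing_eq_dotProduct, D.cycle_dotProduct_cocycle]
    tau_lamS := by simp [crossing_eq_dotProduct, D.cycle_dotProduct_cocycle] }⟩

namespace ElementaryCycles

variable (M : G.ElementaryCycles)

/-- The coordinates on the integral homology with respect to the basis `lam`, `tau`. -/
noncomputable def homologyEquiv : (ℤ × ℤ) ≃ₗ[ℤ] G.Homology ℤ :=
  .ofBijective
    ((LinearMap.toSpanSingleton ℤ _ (G.homologyClass ℤ ⟨M.lam, M.lam_cycle⟩)).coprod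
      (LinearMap.toSpanSingleton ℤ _ (G.homologyClass ℤ ⟨M.tau, M.tau_cycle⟩))) <| by
    refine Function.bijective_iff_existsUnique _ |>.2 fun x => ?_
    obtain ⟨c, rfl⟩ := Submodule.mkQ_surjective _ x
    refine (existsUnique_congr fun m => ?_).1 (M.basis c c.2)
    rw [eq_comm, ← sub_eq_zero, LinearMap.coprod_apply, LinearMap.toSpanSingleton_apply,
      LinearMap.toSpanSingleton_apply, ← map_smul, ← map_smul, ← map_add, ← map_sub]
    exact (G.homologyClass_eq_zero_iff
      (c := c - (m.1 • ⟨M.lam, M.lam_cycle⟩ + m.2 • ⟨M.tau, M.tau_cycle⟩))).symm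

theorem homologyEquiv_symm_tau :
    M.homologyEquiv.symm (G.homologyClass ℤ ⟨M.tau, M.tau_cycle⟩) = (0, 1) := by
  rw [LinearEquiv.symm_apply_eq]
  simp [homologyEquiv]

theorem crossing_tau_lamS : crossing M.tau M.lamS = 1 := by
  -- By duality some cocycle `k` crosses `tau` exactly once; expanding it in the cobasis shows
  -- that `⟨tau, lamS⟩` divides `1`.
  obtain ⟨k, hk, h_pairing⟩ :=
    G.exists_cocycle_of_functional (LinearMap.snd ℤ ℤ ℤ ∘ₗ M.homologyEquiv.symm.toLinearMap)
  have h_tau : M.tau ⬝ᵥ k = 1 := by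
    rw [h_pairing ⟨M.tau, M.tau_cycle⟩, LinearMap.comp_apply, LinearEquiv.coe_coe,
      homologyEquiv_symm_tau, LinearMap.snd_apply]
  obtain ⟨m, hm, -⟩ := M.cobasis k hk
  have h_expansion := G.mem_coboundaries_iff.1 hm M.tau M.tau_cycle
  have h_parallel : M.tau ⬝ᵥ M.tauS = 0 := M.tau_tauS
  rw [dotProduct_sub, dotProduct_add, dotProduct_smul, dotProduct_smul, h_parallel, h_tau,
    ← crossing_eq_dotProduct] at h_expansion
  refine Int.eq_one_of_dvd_one M.tau_lamS.le ⟨m.1, ?_⟩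
  simp only [smul_eq_mul] at h_expansion
  linear_combination h_expansion

theorem crossing_of_hasClass {d : ℕ} {c k : E → ZMod d} (hc : M.HasClass d c 0 1)
    (hk : M.HasCoclass d k 1 0) : crossing c k = 1 := by
  let tau : E → ZMod d := Int.castRingHom (ZMod d) ∘ M.tau
  let lamS : E → ZMod d := Int.castRingHom (ZMod d) ∘ M.lamS
  have h_tau : tau ∈ G.cycles (ZMod d) := by
    have h_int : boundary G.src G.tgt ℤ M.tau = 0 := M.tau_cycle
    rw [LinearMap.mem_ker, bdry₁_eq_boundary, boundary_map, h_int]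
    ext
    simp
  have h_lamS : lamS ∈ G.cocycles (ZMod d) := by
    have h_int : boundary G.right G.left ℤ M.lamS = 0 := M.lamS_cocycle
    rw [LinearMap.mem_ker, cobdry₁_eq_boundary, boundary_map, h_int]
    ext
    simp
  have hc_boundary : c - tau ∈ G.boundaries (ZMod d) := by
    simp only [HasClass, zero_mul, one_mul, zero_add] at hc
    exact hc
  have hk_coboundary : k - lamS ∈ G.coboundaries (ZMod d) := by
    simp only [HasCoclass, zero_mul, one_mul, add_zero] at hk
    exact hk
  have hc_cycle : c ∈ G.cycles (ZMod d) := by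
    simpa using add_mem (G.boundaries_le_cycles _ hc_boundary) h_tau
  calc c ⬝ᵥ k = c ⬝ᵥ lamS := by
        rw [← sub_eq_zero, ← dotProduct_sub, G.mem_coboundaries_iff.1 hk_coboundary c hc_cycle]
    _ = tau ⬝ᵥ lamS := by
        rw [← sub_eq_zero, ← sub_dotProduct, G.mem_boundaries_iff.1 hc_boundary lamS h_lamS]
    _ = 1 := by
        rw [← RingHom.map_dotProduct, ← crossing_eq_dotProduct, M.crossing_tau_lamS, map_one]

end ElementaryCycles

end PolygonDecomposition

/-! ### Phases and loop operators -/

section Phases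

variable {d : ℕ} [NeZero d]

theorem phase_eq_stdAddChar (a : ZMod d) : phase d a = ZMod.stdAddChar a := by
  have h := ZMod.stdAddChar_coe (N := d) a.val
  rw [Int.cast_natCast, Int.cast_natCast, ZMod.natCast_zmod_val] at h
  rw [h, phase, omega, ← Complex.exp_nat_mul]
  congr 1
  ring

theorem norm_phase (a : ZMod d) : ‖phase d a‖ = 1 := by
  rw [phase_eq_stdAddChar, AddChar.norm_apply]

theorem phase_ne_zero (a : ZMod d) : phase d a ≠ 0 :=
  norm_ne_zero_iff.1 (norm_phase a ▸ one_ne_zero)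

theorem phase_eq_one_iff {a : ZMod d} : phase d a = 1 ↔ a = 0 := by
  rw [← phase_zero d, phase_eq_stdAddChar, phase_eq_stdAddChar,
    ZMod.injective_stdAddChar.eq_iff]

theorem phase_neg_one : phase d (-1) = (omega d)⁻¹ := by
  have h := ZMod.stdAddChar_coe (N := d) 1
  rw [Int.cast_one, Int.cast_one, mul_one] at h
  rw [phase_eq_stdAddChar, AddChar.map_neg_eq_inv, h, omega]

open Classical in
theorem sum_phase_apply {A : Type*} [AddCommGroup A] [Fintype A] (φ : A →+ ZMod d) :
    ∑ a, phase d (φ a) = if φ = 0 then (Fintype.card A : ℂ) else 0 := by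
  have h_trivial : (ZMod.stdAddChar : AddChar (ZMod d) ℂ).compAddMonoidHom φ = 0 ↔ φ = 0 := by
    simp [AddChar.ext_iff, AddMonoidHom.ext_iff, ← phase_eq_stdAddChar, phase_eq_one_iff]
  simp only [phase_eq_stdAddChar, ← h_trivial]
  exact AddChar.sum_eq_ite (ZMod.stdAddChar.compAddMonoidHom φ)

end Phases

section LoopOperators

theorem toLinearMap_pow_eq_one_of_map_add {K A H : Type*} [Semiring K] [AddCommMonoid H]
    [Module K H] {d : ℕ} [AddCommGroup A] [Module (ZMod d) A] {U : A → H ≃ₗ[K] H}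
    (hU : ∀ a b, U (a + b) = U a * U b) (a : A) : (U a).toLinearMap ^ d = 1 := by
  let U' : Multiplicative A →* (H ≃ₗ[K] H) := MonoidHom.mk' (fun a => U a.toAdd) fun _ _ => hU _ _
  have h := (LinearEquiv.automorphismGroup.toLinearMapMonoidHom.comp U').map_pow (.ofAdd a) d
  rw [← ofAdd_nsmul, ZModModule.char_nsmul_eq_zero, ofAdd_zero, map_one] at h
  exact h.symm

variable {E : Type*} {d : ℕ} [NeZero d]

theorem opX_apply (c : E → ZMod d) (ψ : Hilb E d) (k : E → ZMod d) :
    opX d c ψ k = ψ (k - c) := rfl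

theorem opX_apply_eq_self_iff {c : E → ZMod d} {ψ : Hilb E d} :
    opX d c ψ = ψ ↔ Function.Periodic ψ c := by
  refine ⟨fun h k => ?_, fun h => PiLp.ext fun k => h.sub_eq k⟩
  have h_apply := opX_apply c ψ (k + c)
  rwa [h, add_sub_cancel_right] at h_apply

variable [Fintype E]

theorem opZ_apply (c : E → ZMod d) (ψ : Hilb E d) (k : E → ZMod d) :
    opZ d c ψ k = phase d (c ⬝ᵥ k) * ψ k := rfl

theorem opZ_apply_eq_self_iff {c : E → ZMod d} {ψ : Hilb E d} :
    opZ d c ψ = ψ ↔ ∀ k, ψ k ≠ 0 → c ⬝ᵥ k = 0 := by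
  simp only [PiLp.ext_iff, opZ_apply, mul_left_eq_self₀, phase_eq_one_iff]
  exact forall_congr' fun k => by rw [or_comm, or_iff_not_imp_left]

theorem norm_opX [DecidableEq E] (c : E → ZMod d) (ψ : Hilb E d) : ‖opX d c ψ‖ = ‖ψ‖ := by
  simp only [EuclideanSpace.norm_eq, opX_apply]
  congr 1
  exact (Equiv.subRight c).sum_comp fun k => ‖ψ k‖ ^ 2

theorem norm_opZ [DecidableEq E] (c : E → ZMod d) (ψ : Hilb E d) : ‖opZ d c ψ‖ = ‖ψ‖ := by
  simp [EuclideanSpace.norm_eq, opZ_apply, norm_phase]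

theorem opZ_opX (c k : E → ZMod d) (ψ : Hilb E d) :
    opZ d c (opX d k ψ) = phase d (c ⬝ᵥ k) • opX d k (opZ d c ψ) := by
  ext m
  rw [PiLp.smul_apply, smul_eq_mul, opZ_apply, opX_apply, opX_apply, opZ_apply, ← mul_assoc,
    ← phase_add, ← dotProduct_add, add_sub_cancel]

theorem opX_opZ_opX_opZ (c c' k k' : E → ZMod d) (ψ : Hilb E d) :
    opX d k (opZ d c (opX d k' (opZ d c' ψ))) =
      phase d (c ⬝ᵥ k') • opX d (k + k') (opZ d (c + c') ψ) := by
  rw [opZ_opX, map_smul, opX_add, opZ_add]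
  rfl

theorem commutator_apply (c k : E → ZMod d) (φ : Hilb E d) :
    (opX d k * opZ d c * (opX d k)⁻¹ * (opZ d c)⁻¹) φ = phase d (-(c ⬝ᵥ k)) • φ := by
  have h := opZ_opX c k ((opX d k)⁻¹ ((opZ d c)⁻¹ φ))
  have h_cancel : opZ d c (opX d k ((opX d k)⁻¹ ((opZ d c)⁻¹ φ))) = φ := by
    simp only [← LinearEquiv.mul_apply, mul_inv_cancel_left, mul_inv_cancel, LinearEquiv.coe_one,
      id]
  rw [h_cancel] at h
  nth_rw 2 [h]
  rw [smul_smul, ← phase_add, neg_add_cancel, phase_zero, one_smul]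
  rfl

end LoopOperators

/-! ### Frustration-free Hamiltonians -/

section PowerAverage

/-- The average of the powers `1, U, …, U ^ (d - 1)` of an operator. If `U ^ d = 1`, it is the
projection to the fixed vectors of `U`. -/
def powerAverage {K H : Type*} [Field K] [AddCommGroup H] [Module K H] (d : ℕ)
    (U : Module.End K H) : Module.End K H :=
  (d : K)⁻¹ • ∑ j ∈ Finset.range d, U ^ j

theorem powerAverage_apply_eq_self_iff {K H : Type*} [Field K] [AddCommGroup H] [Module K H]
    {d : ℕ} (hd : (d : K) ≠ 0) {U : Module.End K H} (hU : U ^ d = 1) {ψ : H} :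
    powerAverage d U ψ = ψ ↔ U ψ = ψ := by
  constructor
  · intro h
    have h_invariant : (U - 1) * powerAverage d U = 0 := by
      rw [powerAverage, mul_smul_comm, mul_geom_sum, hU, sub_self, smul_zero]
    rw [← sub_eq_zero]
    simpa [h] using LinearMap.congr_fun h_invariant ψ
  · intro h
    have h_pow (j : ℕ) : (U ^ j) ψ = ψ := by
      rw [Module.End.pow_apply]
      exact Function.iterate_fixed h j
    simp [powerAverage, h_pow, ← Nat.cast_smul_eq_nsmul K, smul_smul, hd]

theorem norm_powerAverage_apply_le {K H : Type*} [RCLike K] [NormedAddCommGroup H]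
    [NormedSpace K H] {U : Module.End K H} (hU : ∀ ψ, ‖U ψ‖ ≤ ‖ψ‖) (d : ℕ) (ψ : H) :
    ‖powerAverage d U ψ‖ ≤ ‖ψ‖ := by
  have h_pow (j : ℕ) : ‖(U ^ j) ψ‖ ≤ ‖ψ‖ := by
    induction j with
    | zero => exact le_rfl
    | succ j ih => exact pow_succ' U j ▸ (hU _).trans ih
  rw [powerAverage, LinearMap.smul_apply, LinearMap.sum_apply, norm_smul, norm_inv,
    RCLike.norm_natCast]
  calc (d : ℝ)⁻¹ * ‖∑ j ∈ Finset.range d, (U ^ j) ψ‖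
      ≤ (d : ℝ)⁻¹ * (d * ‖ψ‖) := by
        gcongr
        simpa using norm_sum_le_of_le (Finset.range d) fun j _ => h_pow j
    _ ≤ ‖ψ‖ := by
        rw [← mul_assoc]
        exact mul_le_of_le_one_left (norm_nonneg ψ) inv_mul_le_one

end PowerAverage

section FrustrationFree

theorem sum_eq_card_nsmul_iff (K : Type*) {H ι : Type*} [RCLike K] [NormedAddCommGroup H]
    [InnerProductSpace K H] [Fintype ι] {x : ι → H} {y : H} (hx : ∀ i, ‖x i‖ ≤ ‖y‖) :
    ∑ i, x i = Fintype.card ι • y ↔ ∀ i, x i = y := by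
  refine ⟨fun h i => ?_, fun h => by simp [h]⟩
  have h_le (i) : RCLike.re (inner K (x i) y) ≤ ‖y‖ ^ 2 :=
    calc RCLike.re (inner K (x i) y) ≤ ‖x i‖ * ‖y‖ := re_inner_le_norm _ _
      _ ≤ ‖y‖ ^ 2 := by
        rw [sq]
        gcongr
        exact hx i
  have h_sum : ∑ i, RCLike.re (inner K (x i) y) = ∑ _i : ι, ‖y‖ ^ 2 := by
    rw [← map_sum, ← sum_inner, h, ← Nat.cast_smul_eq_nsmul K, inner_smul_left]
    simp
  exact eq_of_norm_le_re_inner_eq_norm_sq (𝕜 := K) (hx i)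
    ((Finset.sum_eq_sum_iff_of_le fun i _ => h_le i).1 h_sum i (Finset.mem_univ i))

variable {K H ι : Type*} [RCLike K] [NormedAddCommGroup H] [InnerProductSpace K H] [Fintype ι]
  {T : ι → Module.End K H}

theorem mem_eigenspace_neg_sum_iff (hT : ∀ i ψ, ‖T i ψ‖ ≤ ‖ψ‖) {ψ : H} :
    ψ ∈ (-∑ i, T i).eigenspace (-(Fintype.card ι : K)) ↔ ∀ i, T i ψ = ψ := by
  rw [Module.End.mem_eigenspace_iff, LinearMap.neg_apply, LinearMap.sum_apply, neg_smul, neg_inj,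
    Nat.cast_smul_eq_nsmul, sum_eq_card_nsmul_iff K fun i => hT i ψ]

theorem isLeast_hasEigenvalue_neg_sum (hT : ∀ i ψ, ‖T i ψ‖ ≤ ‖ψ‖) {ψ : H} (hψ : ψ ≠ 0)
    (h_fixed : ∀ i, T i ψ = ψ) :
    IsLeast {x : ℝ | (-∑ i, T i).HasEigenvalue (x : K)} (-(Fintype.card ι : ℝ)) := by
  constructor
  · refine Module.End.hasEigenvalue_of_hasEigenvector (x := ψ) ⟨?_, hψ⟩
    simpa using (mem_eigenspace_neg_sum_iff hT).2 h_fixed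
  · intro x hx
    obtain ⟨φ, hφ, hφ0⟩ := hx.exists_hasEigenvector
    rw [Module.End.mem_eigenspace_iff, LinearMap.neg_apply, LinearMap.sum_apply] at hφ
    have h_norm : |x| * ‖φ‖ ≤ Fintype.card ι * ‖φ‖ :=
      calc
        |x| * ‖φ‖ = ‖∑ i, T i φ‖ := by
          rw [← norm_neg (∑ i, T i φ), hφ, norm_smul, RCLike.norm_ofReal]
        _ ≤ Fintype.card ι * ‖φ‖ := by
          simpa using norm_sum_le_of_le Finset.univ fun i _ => hT i φ
    exact neg_le_of_abs_le (le_of_mul_le_mul_right h_norm (norm_pos_iff.2 hφ0))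

end FrustrationFree

/-! ### The ground state space -/

namespace PolygonDecomposition

variable {E : Type*} [Fintype E] (G : PolygonDecomposition E) {d : ℕ} [NeZero d]

/-- The local terms of the Hamiltonian: the `A_v` at the vertices and the `B_f` at the faces. -/
noncomputable def localTerm (d : ℕ) [NeZero d] : G.Vertex ⊕ G.Face → Module.End ℂ (Hilb E d) :=
  Sum.elim (G.opA d) (G.opB d)

theorem hamiltonian_eq : G.hamiltonian d = -∑ i, G.localTerm d i := by
  rw [hamiltonian, Fintype.sum_sum_type, neg_add']
  rfl

theorem norm_localTerm_apply_le [DecidableEq E] (i : G.Vertex ⊕ G.Face) (ψ : Hilb E d) :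
    ‖G.localTerm d i ψ‖ ≤ ‖ψ‖ := by
  rcases i with v | f
  · exact norm_powerAverage_apply_le (fun φ => (norm_opX _ φ).le) d ψ
  · exact norm_powerAverage_apply_le (fun φ => (norm_opZ _ φ).le) d ψ

theorem opA_apply_eq_self_iff {E : Type*} [Finite E] (G : PolygonDecomposition E) (v : G.Vertex)
    (ψ : Hilb E d) : G.opA d v ψ = ψ ↔ Function.Periodic ψ (G.vertexSign (ZMod d) v) := by
  cases nonempty_fintype E
  exact (powerAverage_apply_eq_self_iff (NeZero.ne _)
    (toLinearMap_pow_eq_one_of_map_add (opX_add d) _)).trans opX_apply_eq_self_iff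

theorem opB_apply_eq_self_iff (f : G.Face) (ψ : Hilb E d) :
    G.opB d f ψ = ψ ↔ ∀ k, ψ k ≠ 0 → G.faceSign (ZMod d) f ⬝ᵥ k = 0 :=
  (powerAverage_apply_eq_self_iff (NeZero.ne _)
    (toLinearMap_pow_eq_one_of_map_add (opZ_add d) _)).trans opZ_apply_eq_self_iff

theorem forall_periodic_coboundaries_iff {α : Type*} {ψ : (E → ZMod d) → α} :
    (∀ c ∈ G.coboundaries (ZMod d), Function.Periodic ψ c) ↔
      ∀ v, Function.Periodic ψ (G.vertexSign (ZMod d) v) := by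
  classical
  refine ⟨fun h v => h _ ⟨Pi.single v 1, G.cobdry₂_single v⟩, ?_⟩
  rintro h _ ⟨p, rfl⟩
  rw [cobdry₂_eq_sum]
  refine Finset.sum_induction _ (Function.Periodic ψ) (fun _ _ => Function.Periodic.add_period)
    (fun k => by rw [add_zero]) fun v _ => ?_
  rw [← ZMod.natCast_zmod_val (p v), Nat.cast_smul_eq_nsmul]
  exact (h v).nsmul _

theorem mem_cocycles_iff {R : Type*} [CommRing R] {k : E → R} :
    k ∈ G.cocycles R ↔ ∀ f, G.faceSign R f ⬝ᵥ k = 0 :=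
  LinearMap.mem_ker.trans <| funext_iff.trans <|
    forall_congr' fun f => by rw [dotProduct_comm]; rfl

theorem forall_localTerm_apply_eq_self_iff {ψ : Hilb E d} :
    (∀ i, G.localTerm d i ψ = ψ) ↔
      (∀ k, ψ k ≠ 0 → k ∈ G.cocycles (ZMod d)) ∧
        ∀ c ∈ G.coboundaries (ZMod d), Function.Periodic ψ c := by
  rw [Sum.forall, and_comm, forall_periodic_coboundaries_iff]
  refine and_congr ?_ (forall_congr' fun v => G.opA_apply_eq_self_iff v ψ)
  simp only [mem_cocycles_iff]
  exact (forall_congr' fun f => G.opB_apply_eq_self_iff f ψ).trans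
    ⟨fun h k hk f => h f k hk, fun h f k hk => h k hk f⟩

open Classical in
/-- The uniform superposition of the basis states that are cohomologous to `k₀`. -/
noncomputable def classState (d : ℕ) [NeZero d] (k₀ : E → ZMod d) : Hilb E d :=
  WithLp.toLp 2 fun k => if k - k₀ ∈ G.coboundaries (ZMod d) then 1 else 0

open Classical in
theorem classState_apply (k₀ k : E → ZMod d) :
    G.classState d k₀ k = if k - k₀ ∈ G.coboundaries (ZMod d) then 1 else 0 := rfl

theorem localTerm_classState {k₀ : E → ZMod d} (hk₀ : k₀ ∈ G.cocycles (ZMod d)) :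
    ∀ i, G.localTerm d i (G.classState d k₀) = G.classState d k₀ := by
  classical
  refine G.forall_localTerm_apply_eq_self_iff.2 ⟨fun k hk => ?_, fun c hc k => ?_⟩
  · rw [classState_apply, ite_ne_right_iff] at hk
    exact (Submodule.sub_mem_iff_left _ hk₀).1 (G.coboundaries_le_cocycles _ hk.1)
  · rw [classState_apply, classState_apply, add_sub_right_comm, Submodule.add_mem_iff_left _ hc]

theorem classState_ne_zero (k₀ : E → ZMod d) : G.classState d k₀ ≠ 0 := by
  intro h
  simpa [classState_apply] using PiLp.ext_iff.1 h k₀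

theorem groundEnergy_eq : G.groundEnergy d = -(Fintype.card (G.Vertex ⊕ G.Face) : ℝ) := by
  classical
  rw [groundEnergy, hamiltonian_eq]
  exact (isLeast_hasEigenvalue_neg_sum (T := G.localTerm d) G.norm_localTerm_apply_le
    (G.classState_ne_zero 0) (G.localTerm_classState (zero_mem _))).csInf_eq

variable {G}

theorem mem_groundSpace_iff {ψ : Hilb E d} :
    ψ ∈ G.groundSpace d ↔
      (∀ k, ψ k ≠ 0 → k ∈ G.cocycles (ZMod d)) ∧
        ∀ c ∈ G.coboundaries (ZMod d), Function.Periodic ψ c := by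
  classical
  rw [← forall_localTerm_apply_eq_self_iff,
    ← mem_eigenspace_neg_sum_iff (T := G.localTerm d) G.norm_localTerm_apply_le, ← hamiltonian_eq,
    groundSpace, groundEnergy_eq, Complex.ofReal_neg, Complex.ofReal_natCast]

theorem opX_mem_groundSpace {ψ : Hilb E d} (hψ : ψ ∈ G.groundSpace d) {k : E → ZMod d}
    (hk : k ∈ G.cocycles (ZMod d)) : opX d k ψ ∈ G.groundSpace d := by
  rw [mem_groundSpace_iff] at hψ ⊢
  refine ⟨fun m hm => ?_, fun c hc m => ?_⟩
  · exact (Submodule.sub_mem_iff_left _ hk).1 (hψ.1 _ hm)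
  · rw [opX_apply, opX_apply, add_sub_right_comm, hψ.2 c hc]

theorem opZ_mem_groundSpace {ψ : Hilb E d} (hψ : ψ ∈ G.groundSpace d) {c : E → ZMod d}
    (hc : c ∈ G.cycles (ZMod d)) : opZ d c ψ ∈ G.groundSpace d := by
  rw [mem_groundSpace_iff] at hψ ⊢
  refine ⟨fun m hm => hψ.1 m (right_ne_zero_of_mul hm), fun k hk m => ?_⟩
  rw [opZ_apply, opZ_apply, hψ.2 k hk, dotProduct_add, G.mem_coboundaries_iff.1 hk c hc, add_zero]

theorem opZ_apply_of_mem_boundaries {ψ : Hilb E d} (hψ : ψ ∈ G.groundSpace d) {c : E → ZMod d}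
    (hc : c ∈ G.boundaries (ZMod d)) : opZ d c ψ = ψ :=
  opZ_apply_eq_self_iff.2 fun k hk =>
    G.mem_boundaries_iff.1 hc k ((mem_groundSpace_iff.1 hψ).1 k hk)

/-! ### Irreducibility of the loop operators -/

open Classical in
theorem sum_cycles_phase [Fintype (G.cycles (ZMod d))] (k : E → ZMod d) :
    ∑ c : G.cycles (ZMod d), phase d (c ⬝ᵥ k) =
      if k ∈ G.coboundaries (ZMod d) then (Fintype.card (G.cycles (ZMod d)) : ℂ) else 0 := by
  let φ : G.cycles (ZMod d) →+ ZMod d :=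
    { toFun := fun c => c ⬝ᵥ k
      map_zero' := zero_dotProduct k
      map_add' := fun a b => add_dotProduct (a : E → ZMod d) b k }
  have h_trivial : φ = 0 ↔ k ∈ G.coboundaries (ZMod d) := by
    rw [mem_coboundaries_iff, AddMonoidHom.ext_iff, Subtype.forall]
    rfl
  simp only [← h_trivial]
  exact sum_phase_apply φ

variable (G) in
/-- The span of the images of a state under the loop operators `X_k Z_c`, over cocycles `k` and
cycles `c`. -/
noncomputable def loopSpan (d : ℕ) [NeZero d] (Ψ : Hilb E d) : Submodule ℂ (Hilb E d) :=
  Submodule.span ℂ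
    {φ | ∃ c ∈ G.cycles (ZMod d), ∃ k ∈ G.cocycles (ZMod d), φ = opX d k (opZ d c Ψ)}

theorem opX_mem_loopSpan {Ψ φ : Hilb E d} (hφ : φ ∈ G.loopSpan d Ψ) {k : E → ZMod d}
    (hk : k ∈ G.cocycles (ZMod d)) : opX d k φ ∈ G.loopSpan d Ψ := by
  suffices h : (G.loopSpan d Ψ).map (opX d k).toLinearMap ≤ G.loopSpan d Ψ from
    h (Submodule.mem_map_of_mem hφ)
  rw [loopSpan, Submodule.map_span_le]
  rintro _ ⟨c, hc, k', hk', rfl⟩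
  refine Submodule.subset_span ⟨c, hc, k + k', add_mem hk hk', ?_⟩
  rw [opX_add]
  rfl

theorem sum_cycles_phase_smul_opZ [Fintype (G.cycles (ZMod d))] {Ψ : Hilb E d}
    (hΨ : Ψ ∈ G.groundSpace d) (k₀ : E → ZMod d) :
    ∑ c : G.cycles (ZMod d), phase d (-(c ⬝ᵥ k₀)) • opZ d c Ψ =
      (Fintype.card (G.cycles (ZMod d)) * Ψ k₀) • G.classState d k₀ := by
  ext k
  simp only [WithLp.ofLp_sum, WithLp.ofLp_smul, Finset.sum_apply, Pi.smul_apply, smul_eq_mul,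
    opZ_apply, classState_apply, ← mul_assoc, ← phase_add, neg_add_eq_sub, ← dotProduct_sub]
  rw [← Finset.sum_mul, sum_cycles_phase]
  split_ifs with h
  · have h_period : Ψ k = Ψ k₀ := by
      rw [← (mem_groundSpace_iff.1 hΨ).2 _ h k₀, add_sub_cancel]
    rw [h_period, mul_one]
  · rw [zero_mul, mul_zero]

theorem classState_mem_loopSpan {Ψ : Hilb E d} (hΨ : Ψ ∈ G.groundSpace d) {k₀ : E → ZMod d}
    (hk₀ : Ψ k₀ ≠ 0) : G.classState d k₀ ∈ G.loopSpan d Ψ := by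
  let _ : Fintype (G.cycles (ZMod d)) := Fintype.ofFinite _
  have h_ne : (Fintype.card (G.cycles (ZMod d)) * Ψ k₀ : ℂ) ≠ 0 :=
    mul_ne_zero (Nat.cast_ne_zero.2 Fintype.card_ne_zero) hk₀
  rw [← Submodule.smul_mem_iff _ h_ne, ← sum_cycles_phase_smul_opZ hΨ]
  refine sum_mem fun c _ => Submodule.smul_mem _ _ (Submodule.subset_span
    ⟨c, c.2, 0, zero_mem _, ?_⟩)
  rw [opX_apply_eq_self_iff.2]
  exact fun k => by rw [add_zero]

theorem opX_classState (k k₀ : E → ZMod d) :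
    opX d k (G.classState d k₀) = G.classState d (k₀ + k) := by
  ext m
  rw [opX_apply, classState_apply, classState_apply, sub_sub, add_comm k]

theorem sum_smul_classState [DecidableEq E] [Fintype (G.coboundaries (ZMod d))] {φ : Hilb E d}
    (hφ : ∀ c ∈ G.coboundaries (ZMod d), Function.Periodic φ c) :
    ∑ k, φ k • G.classState d k = (Fintype.card (G.coboundaries (ZMod d)) : ℂ) • φ := by
  classical
  ext m
  simp only [WithLp.ofLp_sum, WithLp.ofLp_smul, Finset.sum_apply, Pi.smul_apply, smul_eq_mul,
    classState_apply, mul_ite, mul_one, mul_zero]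
  rw [← Equiv.sum_comp (Equiv.subLeft m)]
  simp only [Equiv.subLeft_apply, sub_sub_cancel]
  rw [← Finset.sum_filter, Finset.sum_congr rfl (g := fun _ => φ m)]
  · rw [Finset.sum_const, nsmul_eq_mul, ← Fintype.card_subtype]
  · exact fun c hc => (hφ c (Finset.mem_filter.1 hc).2).sub_eq m

theorem loopSpan_eq_groundSpace {Ψ : Hilb E d} (hΨ : Ψ ∈ G.groundSpace d) (hΨ0 : Ψ ≠ 0) :
    G.loopSpan d Ψ = G.groundSpace d := by
  classical
  refine le_antisymm (Submodule.span_le.2 ?_) fun φ hφ => ?_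
  · rintro _ ⟨c, hc, k, hk, rfl⟩
    exact opX_mem_groundSpace (opZ_mem_groundSpace hΨ hc) hk
  obtain ⟨k₀, hk₀⟩ : ∃ k₀, Ψ k₀ ≠ 0 := by
    by_contra! h
    exact hΨ0 (PiLp.ext h)
  have h_classState {k} (hk : k ∈ G.cocycles (ZMod d)) : G.classState d k ∈ G.loopSpan d Ψ := by
    have h := opX_mem_loopSpan (classState_mem_loopSpan hΨ hk₀)
      (sub_mem hk ((mem_groundSpace_iff.1 hΨ).1 k₀ hk₀))
    rwa [opX_classState, add_sub_cancel] at h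
  rw [mem_groundSpace_iff] at hφ
  have h_card : (Fintype.card (G.coboundaries (ZMod d)) : ℂ) ≠ 0 :=
    Nat.cast_ne_zero.2 Fintype.card_ne_zero
  rw [← Submodule.smul_mem_iff _ h_card, ← sum_smul_classState hφ.2]
  refine sum_mem fun k _ => ?_
  by_cases hk : φ k = 0
  · rw [hk, zero_smul]
    exact zero_mem _
  · exact Submodule.smul_mem _ _ (h_classState (hφ.1 k hk))

end PolygonDecomposition

/-! ### Excited states and braiding -/

namespace DartWalk

variable {E A : Type*} {s t : Dart E → A} {x y : A}

theorem start_mem_support (p : DartWalk s t x y) : x ∈ p.support := by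
  cases p <;> simp [support]

theorem mem_support_of_chain_ne_zero {R : Type*} [CommRing R] (h : ∀ a, s (flip E a) = t a)
    (p : DartWalk s t x y) {e : E} (he : p.chain R e ≠ 0) :
    s (e, true) ∈ p.support ∧ t (e, true) ∈ p.support := by
  classical
  induction p with
  | nil => exact absurd rfl he
  | cons a hs ht p ih =>
    rw [support]
    by_cases hea : e = a.1
    · subst hea hs ht
      have h_start := p.start_mem_support
      rcases a with ⟨e, _ | _⟩
      · have h_src : s (e, false) = t (e, true) := h (e, true)
        have h_tgt : s (e, true) = t (e, false) := h (e, false)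
        simp [h_src, h_tgt, h_start]
      · simp [h_start]
    · rw [chain, Pi.add_apply, Pi.single_eq_of_ne hea, zero_add] at he
      exact (ih he).imp (List.mem_cons_of_mem _) (List.mem_cons_of_mem _)

end DartWalk

namespace PolygonDecomposition

section Chains

variable {E : Type*} {G : PolygonDecomposition E} {R : Type*} [CommRing R]

theorem left_ne_right (a : Dart E) : G.left a ≠ G.right a := by
  rcases a with ⟨e, _ | _⟩
  · exact fun h => G.sides_ne e (Quotient.exact h.symm)
  · exact fun h => G.sides_ne e (Quotient.exact h)

theorem faceSign_right (a : Dart E) :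
    G.faceSign R (G.right a) a.1 * (if a.2 = true then 1 else -1) = -1 := by
  have h := G.left_ne_right a
  rcases a with ⟨e, _ | _⟩
  · have h_left : G.left (e, true) = G.right (e, false) := rfl
    have h_right : G.right (e, true) = G.left (e, false) := rfl
    simp [faceSign, h_left, h_right, h]
  · simp [faceSign, h]

theorem eq_left_or_eq_right_of_faceSign_ne_zero {f : G.Face} {e : E} (h : G.faceSign R f e ≠ 0) :
    f = G.right (e, true) ∨ f = G.left (e, true) := by
  contrapose! h
  simp [faceSign, h.1.symm, h.2.symm]

theorem faceSign_crosses_once {f g : G.Face} (hfg : f ≠ g) (γs : G.Cowalk f g)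
    (hγs : γs.support.Nodup) :
    ∃ e : E, G.faceSign R f e * γs.chain R e = -1 ∧
      ∀ e' : E, G.faceSign R f e' ≠ 0 → γs.chain R e' ≠ 0 → e' = e := by
  classical
  cases γs with
  | nil => exact absurd rfl hfg
  | cons a hs ht p =>
    rw [DartWalk.support, List.nodup_cons] at hγs
    have h_rest {e} (he : G.faceSign R f e ≠ 0) : p.chain R e = 0 := by
      by_contra h_chain
      have h_support := p.mem_support_of_chain_ne_zero G.right_flip h_chain
      rcases eq_left_or_eq_right_of_faceSign_ne_zero he with rfl | rfl
      · exact hγs.1 h_support.1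
      · exact hγs.1 h_support.2
    subst hs
    refine ⟨a.1, ?_, fun e' h_sign h_chain => ?_⟩
    · have h_mul : G.faceSign R (G.right a) a.1 * p.chain R a.1 = 0 := by
        by_contra h
        exact right_ne_zero_of_mul h (h_rest (left_ne_zero_of_mul h))
      rw [DartWalk.chain, Pi.add_apply, Pi.single_eq_same, mul_add, h_mul, add_zero,
        faceSign_right]
    · by_contra h_ne
      rw [DartWalk.chain, Pi.add_apply, Pi.single_eq_of_ne h_ne, h_rest h_sign,
        add_zero] at h_chain
      exact h_chain rfl

variable [Fintype E]

theorem Walk.chain_sub_chain_mem_cycles {v w : G.Vertex} (p q : G.Walk v w) :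
    p.chain R - q.chain R ∈ G.cycles R := by
  rw [LinearMap.mem_ker, map_sub, bdry₁_eq_boundary,
    DartWalk.boundary_chain R G.walk_isConnectedGraph.src_flip,
    DartWalk.boundary_chain R G.walk_isConnectedGraph.src_flip, sub_self]

theorem Cowalk.chain_sub_chain_mem_cocycles {f g : G.Face} (p q : G.Cowalk f g) :
    p.chain R - q.chain R ∈ G.cocycles R := by
  rw [LinearMap.mem_ker, map_sub, cobdry₁_eq_boundary, DartWalk.boundary_chain R G.right_flip,
    DartWalk.boundary_chain R G.right_flip, sub_self]

theorem exists_isBraidingLoop {d : ℕ} (v : G.Vertex) {f g : G.Face} (hfg : f ≠ g)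
    (γs : G.Cowalk f g) (hγs : γs.support.Nodup) : ∃ τ : G.Walk v v, G.IsBraidingLoop d γs τ := by
  classical
  have h_boundary : G.faceSign (ZMod d) f ∈ G.boundaries (ZMod d) :=
    ⟨Pi.single f 1, G.bdry₂_single f⟩
  obtain ⟨τ, hτ⟩ :=
    G.walk_isConnectedGraph.exists_closedWalk v (G.boundaries_le_cycles _ h_boundary)
  exact ⟨τ, hτ ▸ h_boundary, hτ ▸ faceSign_crosses_once hfg γs hγs⟩

theorem IsBraidingLoop.dotProduct_chain_eq {d : ℕ} {v : G.Vertex} {f g : G.Face}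
    {γs : G.Cowalk f g} {τ : G.Walk v v} (h : G.IsBraidingLoop d γs τ) :
    τ.chain (ZMod d) ⬝ᵥ γs.chain (ZMod d) = -1 := by
  obtain ⟨e, he, h_unique⟩ := h.crossesOnce
  rw [dotProduct, Fintype.sum_eq_single e fun e' hne => ?_, he]
  by_contra h_ne_zero
  exact hne (h_unique e' (left_ne_zero_of_mul h_ne_zero) (right_ne_zero_of_mul h_ne_zero))

end Chains

variable {E : Type*} [Fintype E] {G : PolygonDecomposition E} {d : ℕ} [NeZero d]

theorem pairSpace_eq {v w : G.Vertex} {f g : G.Face} {Ψ : Hilb E d} (hΨ : Ψ ∈ G.groundSpace d)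
    (hΨ0 : Ψ ≠ 0) (γ : G.Walk v w) (γs : G.Cowalk f g) :
    G.pairSpace d v w f g Ψ =
      (G.groundSpace d).map
        (opX d (γs.chain (ZMod d)) * opZ d (γ.chain (ZMod d))).toLinearMap := by
  set U := (opX d (γs.chain (ZMod d)) * opZ d (γ.chain (ZMod d))).toLinearMap
  have h_loop (c k : E → ZMod d) : U (opX d k (opZ d c Ψ)) =
      phase d (γ.chain (ZMod d) ⬝ᵥ k) •
        opX d (γs.chain (ZMod d) + k) (opZ d (γ.chain (ZMod d) + c) Ψ) :=
    opX_opZ_opX_opZ _ _ _ _ Ψ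
  rw [← loopSpan_eq_groundSpace hΨ hΨ0]
  refine le_antisymm (Submodule.span_le.2 ?_) ((Submodule.map_span_le _ _ _).2 ?_)
  · rintro _ ⟨γ', γs', rfl⟩
    have h_gen : opX d (γs'.chain (ZMod d) - γs.chain (ZMod d))
        (opZ d (γ'.chain (ZMod d) - γ.chain (ZMod d)) Ψ) ∈ G.loopSpan d Ψ :=
      Submodule.subset_span
        ⟨_, γ'.chain_sub_chain_mem_cycles γ, _, γs'.chain_sub_chain_mem_cocycles γs, rfl⟩
    have h_mem := Submodule.mem_map_of_mem (f := U) h_gen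
    rw [h_loop, add_sub_cancel, add_sub_cancel] at h_mem
    exact (Submodule.smul_mem_iff _ (phase_ne_zero _)).1 h_mem
  · rintro _ ⟨c, hc, k, hk, rfl⟩
    obtain ⟨γ', hγ'⟩ := G.walk_isConnectedGraph.exists_walk_chain γ hc
    obtain ⟨γs', hγs'⟩ := G.cowalk_isConnectedGraph.exists_walk_chain γs hk
    rw [h_loop, add_comm _ k, add_comm _ c, ← hγ', ← hγs']
    exact Submodule.smul_mem _ _ (Submodule.subset_span ⟨γ', γs', rfl⟩)

theorem opZ_opX_opZ_of_mem_boundaries {ψ : Hilb E d} (hψ : ψ ∈ G.groundSpace d)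
    {b : E → ZMod d} (hb : b ∈ G.boundaries (ZMod d)) (c k : E → ZMod d) :
    opZ d b (opX d k (opZ d c ψ)) = phase d (b ⬝ᵥ k) • opX d k (opZ d c ψ) := by
  have h_fixed : opZ d b (opZ d c ψ) = opZ d c ψ := by
    rw [← LinearEquiv.mul_apply, ← opZ_add, add_comm, opZ_add, LinearEquiv.mul_apply,
      opZ_apply_of_mem_boundaries hψ hb]
  rw [opZ_opX, h_fixed]

namespace IsBraidingLoop

variable {v w : G.Vertex} {f g : G.Face} {γs : G.Cowalk f g} {τ : G.Walk v v}

theorem braiding_apply (h : G.IsBraidingLoop d γs τ) {Ψ : Hilb E d} (hΨ : Ψ ∈ G.groundSpace d)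
    (hΨ0 : Ψ ≠ 0) {φ : Hilb E d} (hφ : φ ∈ G.pairSpace d v w f g Ψ) :
    G.braiding d τ φ = (omega d)⁻¹ • φ := by
  obtain ⟨γ⟩ := G.walk_isConnectedGraph.reachable v w
  rw [pairSpace_eq hΨ hΨ0 γ γs] at hφ
  obtain ⟨ψ, hψ, rfl⟩ := hφ
  rw [← phase_neg_one, ← h.dotProduct_chain_eq]
  exact opZ_opX_opZ_of_mem_boundaries hψ h.isBoundary _ _

end IsBraidingLoop

end PolygonDecomposition

end Kitaev

theorem mainTheorem2 {E : Type*} [Fintype E] (G : Kitaev.PolygonDecomposition E)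
    (hG : G.HasGenus 1) (d : ℕ) [NeZero d]
    (v w : G.Vertex) (f g : G.Face) (hvw : v ≠ w) (hfg : f ≠ g)
    (Ψ : Kitaev.Hilb E d) (hΨ : Ψ ∈ G.groundSpace d) (hΨ0 : Ψ ≠ 0) :
    -- the space of the excited states is the image of the ground state space
    (∀ (γ : G.Walk v w) (γs : G.Cowalk f g),
      G.pairSpace d v w f g Ψ =
        (G.groundSpace d).map
          (Kitaev.opX d (γs.chain (ZMod d)) * Kitaev.opZ d (γ.chain (ZMod d))).toLinearMap) ∧
    Module.finrank ℂ (G.pairSpace d v w f g Ψ) = Module.finrank ℂ (G.groundSpace d) ∧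
    (∀ Ψ' ∈ G.groundSpace d, Ψ' ≠ 0 →
      G.pairSpace d v w f g Ψ' = G.pairSpace d v w f g Ψ) ∧
    -- braiding loops and elementary (co)cycles exist
    (∀ γs : G.Cowalk f g, γs.support.Nodup → ∃ τ : G.Walk v v, G.IsBraidingLoop d γs τ) ∧
    Nonempty G.ElementaryCycles ∧
    -- the braiding is the commutator of the global loop operators, and is a phase
    (∀ (γs : G.Cowalk f g) (τ : G.Walk v v), G.IsBraidingLoop d γs τ →
      ∀ φ ∈ G.pairSpace d v w f g Ψ,
        (∀ (M : G.ElementaryCycles) (c cs : E → ZMod d), M.HasClass d c 0 1 →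
          M.HasCoclass d cs 1 0 →
          G.braiding d τ φ =
            (Kitaev.opX d cs * Kitaev.opZ d c * (Kitaev.opX d cs)⁻¹ * (Kitaev.opZ d c)⁻¹) φ) ∧
        G.braiding d τ φ = (Kitaev.omega d)⁻¹ • φ) := by
  have h_pair {Φ : Kitaev.Hilb E d} (hΦ : Φ ∈ G.groundSpace d) (hΦ0 : Φ ≠ 0) :=
    Kitaev.PolygonDecomposition.pairSpace_eq (v := v) (w := w) (f := f) (g := g) hΦ hΦ0
  obtain ⟨γ₀⟩ := G.walk_isConnectedGraph.reachable v w
  obtain ⟨γs₀⟩ := G.cowalk_isConnectedGraph.reachable f g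
  refine ⟨h_pair hΨ hΨ0, ?_, fun Ψ' hΨ' hΨ'0 => ?_,
    fun γs => Kitaev.PolygonDecomposition.exists_isBraidingLoop v hfg γs,
    Kitaev.PolygonDecomposition.nonempty_elementaryCycles hG, fun γs τ hτ φ hφ => ?_⟩
  · rw [h_pair hΨ hΨ0 γ₀ γs₀]
    exact LinearEquiv.finrank_map_eq _ _
  · rw [h_pair hΨ hΨ0 γ₀ γs₀, h_pair hΨ' hΨ'0 γ₀ γs₀]
  · have h_braiding := hτ.braiding_apply hΨ hΨ0 hφ
    refine ⟨fun M c cs hc hcs => ?_, h_braiding⟩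
    rw [h_braiding, Kitaev.commutator_apply, ← Kitaev.crossing_eq_dotProduct,
      M.crossing_of_hasClass hc hcs, Kitaev.phase_neg_one]
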